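/- Let $(P,\le)$ be a finite poset and let $G=\mathrm{inc}(P)$ be its incomparability graph: its vertices are the elements of $P$, and $x,y$ are adjacent if and only if neither $x\le y$ nor $y\le x$. Let $X_G=\sum_{\mathcal C}\prod_{v\in P}x_{\mathcal C(v)}$ be its chromatic symmetric function in countably many variables over $\mathbb{Q}$, where $\mathcal C$ runs over all proper colorings of $G$ with positive integer colors. For a partition $\lambda$ let $s_\lambda$ be the Schur function, i.e. the sum of the weights of all semistandard Young tableaux of shape $\lambda$. Then $X_G$ has a unique expansion as a finite $\mathbb{Q}$-linear combination of Schur functions, and for every partition $\lambda$ the coefficient $[s_\lambda]X_G$ of $s_\lambda$ in it is $$[s_\lambda]X_G=\sum_{T\in\tilde{\mathcal T}_{\lambda,G}}\mathrm{sgn}(T),$$ with the following notation. A rim hook of a Young diagram (English notation: left-justified rows of weakly decreasing length, listed from top to bottom) is a nonempty connected sequence of cells $(i,j)$ of the diagram, read from southwest to northeast by north steps and east steps, all lying on the southeast boundary (that is, $(i+1,j+1)$ is not in the diagram), whose removal leaves a Young diagram. A special rim hook (SRH) tabloid of shape $\lambda$ is a sequence $(r_1,\dots,r_m)$ such that $r_1$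 is a rim hook of the diagram of $\lambda$, each $r_{i+1}$ is a rim hook of the diagram that remains after $r_1,\dots,r_i$ are removed, no cell remains at the end, and every $r_i$ meets the first column. An SRH $G$-tabloid of shape $\lambda$ is an SRH tabloid of shape $\lambda$ together with a filling of its cells by the vertices of $G$, each vertex being used exactly once, such that the vertices in each rim hook form a stable set (pairwise non-adjacent) of $G$ and increase with respect to $\le$ when the rim hook is read from southwest to northeast. Its sign is $\mathrm{sgn}(T)=(-1)^{N(T)}$, where $N(T)$ is the total number of north steps in its rim hooks. Its tail sequence is the sequence $(v_1,\dots,v_k)$ of the vertices in the rows of length $1$, read from bottom to top. Finally, $\tilde{\mathcal T}_{\lambda,G}$ is the set of all SRH $G$-tabloids of shape $\lambda$ whose tail sequence is non-increasing, that is, $v_i\not\le v_{i+1}$ for all $1\le i\le k-1$. -/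

import Mathlib

noncomputable section

namespace SRH

/-! ### Symmetric functions and Schur coefficients

Power series in countably many variables `x 0, x 1, x 2, …` over `ℚ` are elements of
`MvPowerSeries ℕ ℚ`; partitions are Young diagrams in English notation, where the cell `(i, j)`
lies in row `i` (from the top) and in column `j` (from the left), both counted from `0`. -/

/-- The exponent vector of the weight of a semistandard Young tableau. -/
def ssytWeight {lam : YoungDiagram} (Q : SemistandardYoungTableau lam) : ℕ →₀ ℕ :=
  ∑ c ∈ lam.cells, Finsupp.single (Q c.1 c.2) 1

/-- The Schur function `s_lam = ∑_Q wt(Q)`: the coefficient of a monomial is the number of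
semistandard Young tableaux of shape `lam` with that weight. -/
def schur (lam : YoungDiagram) : MvPowerSeries ℕ ℚ :=
  fun d => (Nat.card {Q : SemistandardYoungTableau lam // ssytWeight Q = d} : ℚ)

/-- The exponent vector of the monomial of a colouring. -/
def coloringWeight {V : Type*} [Fintype V] {G : SimpleGraph V} (C : G.Coloring ℕ) : ℕ →₀ ℕ :=
  ∑ v, Finsupp.single (C v) 1

/-- The chromatic symmetric function `X_G = ∑_C x^C` over all proper colourings `C`: the
coefficient of a monomial is the number of proper colourings with that monomial. -/
def chromaticSymm {V : Type*} [Fintype V] (G : SimpleGraph V) : MvPowerSeries ℕ ℚ :=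
  fun d => (Nat.card {C : G.Coloring ℕ // coloringWeight C = d} : ℚ)

/-- `a` is a (finite) expansion of `f` in Schur functions. -/
def IsSchurExpansion (f : MvPowerSeries ℕ ℚ) (a : YoungDiagram →₀ ℚ) : Prop :=
  Finsupp.linearCombination ℚ schur a = f

open Classical in
/-- `[s_lam] f`, the coefficient of `s_lam` in the expansion of `f` in Schur functions
(and `0` if `f` has no such expansion). -/
def schurCoeff (lam : YoungDiagram) (f : MvPowerSeries ℕ ℚ) : ℚ :=
  if h : ∃ a, IsSchurExpansion f a then h.choose lam else 0

/-- The incomparability graph of a poset. -/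
def incGraph (P : Type*) [PartialOrder P] : SimpleGraph P where
  Adj x y := ¬ x ≤ y ∧ ¬ y ≤ x
  symm := ⟨fun _ _ h => ⟨h.2, h.1⟩⟩
  loopless := ⟨fun _ h => h.1 le_rfl⟩

/-! ### Special rim hook tabloids -/

/-- The step from cell `c` to cell `d` is a north step. -/
def NorthStep (c d : ℕ × ℕ) : Prop := c.1 = d.1 + 1 ∧ c.2 = d.2

/-- The step from cell `c` to cell `d` is an east step. -/
def EastStep (c d : ℕ × ℕ) : Prop := c.1 = d.1 ∧ d.2 = c.2 + 1

instance (c d : ℕ × ℕ) : Decidable (NorthStep c d) := by unfold NorthStep; infer_instance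

/-- The list `r` is a rim hook of `lam`, read from southwest to northeast: a nonempty connected
sequence of cells of `lam` on the southeast boundary, whose removal leaves a diagram. -/
structure IsRimHook (lam : YoungDiagram) (r : List (ℕ × ℕ)) : Prop where
  ne_nil : r ≠ []
  connected : r.IsChain fun c d => NorthStep c d ∨ EastStep c d
  mem : ∀ c ∈ r, c ∈ lam
  boundary : ∀ c ∈ r, (c.1 + 1, c.2 + 1) ∉ lam
  removable : IsLowerSet ((lam.cells \ r.toFinset : Finset (ℕ × ℕ)) : Set (ℕ × ℕ))

/-- `IsRimHookTabloid lam [r₁, …, r_j]`: the first entry is a rim hook of `lam`, the second a rim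
hook of the diagram that is left when the first one is removed, and so on until no cell is left. -/
inductive IsRimHookTabloid : YoungDiagram → List (List (ℕ × ℕ)) → Prop
  | nil : IsRimHookTabloid ⊥ []
  | cons {lam nu : YoungDiagram} {r : List (ℕ × ℕ)} {rs : List (List (ℕ × ℕ))} :
      IsRimHook lam r → nu.cells = lam.cells \ r.toFinset → IsRimHookTabloid nu rs →
      IsRimHookTabloid lam (r :: rs)

/-- Special rim hook tabloids of shape `lam`: every rim hook meets the first column. (Then each
rim hook contains the lowest cell of the first column that is left, so the rim hooks are listed
from bottom to top, and the list is determined by the underlying picture.) -/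
@[ext]
structure SRHTabloid (lam : YoungDiagram) where
  hooks : List (List (ℕ × ℕ))
  isRimHookTabloid : IsRimHookTabloid lam hooks
  special : ∀ r ∈ hooks, ∃ c ∈ r, c.2 = 0

/-- The number of north steps in a rim hook read from southwest to northeast. -/
def northSteps (r : List (ℕ × ℕ)) : ℕ :=
  (r.zip r.tail).countP fun p => decide (NorthStep p.1 p.2)

/-- The sign of a special rim hook tabloid. -/
def SRHTabloid.sgn {lam : YoungDiagram} (T : SRHTabloid lam) : ℤ :=
  (-1) ^ (T.hooks.map northSteps).sum

/-- Special rim hook `G`-tabloids of shape `lam`, with respect to a partial order on the vertices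
of `G`: special rim hook tabloids whose cells are filled with the vertices of `G`, each vertex
being used exactly once, such that the vertices in each rim hook form a stable set and increase
from southwest to northeast. -/
@[ext]
structure SRHGTabloid {V : Type*} [PartialOrder V] (G : SimpleGraph V) (lam : YoungDiagram)
    extends SRHTabloid lam where
  fill : {c : ℕ × ℕ // c ∈ lam} ≃ V
  stable : ∀ r ∈ hooks, G.IsIndepSet {v | ∃ c : {c : ℕ × ℕ // c ∈ lam}, c.1 ∈ r ∧ fill c = v}
  increasing : ∀ r ∈ hooks, r.Pairwise fun c d =>
    ∀ (hc : c ∈ lam) (hd : d ∈ lam), fill ⟨c, hc⟩ < fill ⟨d, hd⟩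

/-- The tail sequence: the vertices in the rows of length `1`, read from bottom to top. -/
def SRHGTabloid.tailSeq {V : Type*} [PartialOrder V] {G : SimpleGraph V} {lam : YoungDiagram}
    (T : SRHGTabloid G lam) : List V :=
  (List.range (lam.colLen 0)).reverse.filterMap fun i =>
    if h : lam.rowLen i = 1 then
      some (T.fill ⟨(i, 0), YoungDiagram.mem_iff_lt_rowLen.2 (h ▸ Nat.one_pos)⟩)
    else none

/-- Non-increasing sequences `(v₁, …, v_k)`: no `i` has `v_i ≤ v_{i+1}`. -/
def NonIncreasing {V : Type*} [PartialOrder V] (s : List V) : Prop :=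
  s.IsChain fun u v => ¬ u ≤ v

/-! ### Finiteness -/

theorem finite_ssyt (lam : YoungDiagram) (d : ℕ →₀ ℕ) :
    Finite {Q : SemistandardYoungTableau lam // ssytWeight Q = d} := by
  have hmem : ∀ Q : {Q : SemistandardYoungTableau lam // ssytWeight Q = d},
      ∀ c : {c : ℕ × ℕ // c ∈ lam.cells}, Q.1 c.1.1 c.1.2 ∈ d.support := by
    rintro ⟨Q, rfl⟩ c
    rw [Finsupp.mem_support_iff]
    unfold ssytWeight
    rw [Finsupp.finsetSum_apply]
    exact (Finset.sum_pos' (fun _ _ => Nat.zero_le _) ⟨c.1, c.2, by simp⟩).ne'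
  refine Finite.of_injective
    (β := {c : ℕ × ℕ // c ∈ lam.cells} → {n : ℕ // n ∈ d.support})
    (fun Q c => ⟨_, hmem Q c⟩) fun Q Q' h => Subtype.ext ?_
  ext i j
  by_cases hij : (i, j) ∈ lam.cells
  · exact congrArg Subtype.val (congrFun h ⟨(i, j), hij⟩)
  · rw [Q.1.zeros hij, Q'.1.zeros hij]

theorem finite_coloring {V : Type*} [Fintype V] (G : SimpleGraph V) (d : ℕ →₀ ℕ) :
    Finite {C : G.Coloring ℕ // coloringWeight C = d} := by
  have hmem : ∀ C : {C : G.Coloring ℕ // coloringWeight C = d},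
      ∀ v, C.1 v ∈ d.support := by
    rintro ⟨C, rfl⟩ v
    rw [Finsupp.mem_support_iff]
    unfold coloringWeight
    rw [Finsupp.finsetSum_apply]
    exact (Finset.sum_pos' (fun _ _ => Nat.zero_le _) ⟨v, Finset.mem_univ v, by simp⟩).ne'
  refine Finite.of_injective (β := V → {n : ℕ // n ∈ d.support})
    (fun C v => ⟨_, hmem C v⟩) fun C C' h => Subtype.ext ?_
  ext v
  exact congrArg Subtype.val (congrFun h v)

theorem finite_isRimHook (lam : YoungDiagram) : {r | IsRimHook lam r}.Finite := by
  have key : ∀ r : List (ℕ × ℕ), (r.IsChain fun c d => NorthStep c d ∨ EastStep c d) →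
      r.Nodup := by
    intro r h
    have h2 : r.Pairwise fun c d : ℕ × ℕ => (c.2 : ℤ) - c.1 < d.2 - d.1 := by
      have : IsTrans (ℕ × ℕ) fun c d => (c.2 : ℤ) - c.1 < d.2 - d.1 :=
        ⟨fun _ _ _ h1 h2 => lt_trans h1 h2⟩
      apply List.IsChain.pairwise
      refine h.imp ?_
      intro c d hcd
      unfold NorthStep EastStep at hcd
      omega
    exact h2.imp fun {c d} hcd e => by subst e; exact lt_irrefl _ hcd
  have hfin : {r : List {c : ℕ × ℕ // c ∈ lam.cells} | r.Nodup}.Finite :=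
    Set.finite_coe_iff.1
      (Finite.of_fintype {r : List {c : ℕ × ℕ // c ∈ lam.cells} // r.Nodup})
  refine (hfin.image (List.map Subtype.val)).subset ?_
  intro r hr
  have hval : (r.attachWith (· ∈ lam.cells) hr.mem).map Subtype.val = r := List.attachWith_map_subtype_val _
  refine ⟨r.attachWith (· ∈ lam.cells) hr.mem, List.Nodup.of_map Subtype.val ?_, hval⟩
  rw [hval]
  exact key r hr.connected

theorem finite_isRimHookTabloid (lam : YoungDiagram) :
    {rs | IsRimHookTabloid lam rs}.Finite := by
  induction hn : lam.card using Nat.strong_induction_on generalizing lam with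
  | _ n ih =>
    have hfin : ((⋃ r ∈ {r | IsRimHook lam r}, ⋃ nu ∈ {nu : YoungDiagram |
        nu.cells = lam.cells \ r.toFinset}, (List.cons r) '' {rs | IsRimHookTabloid nu rs})
        ∪ {[]}).Finite := by
      refine Set.Finite.union ?_ (Set.finite_singleton _)
      refine (finite_isRimHook lam).biUnion fun r hr => ?_
      refine Set.Finite.biUnion (Set.Subsingleton.finite fun a ha b hb => ?_) fun nu hnu => ?_
      · exact YoungDiagram.ext (ha.trans hb.symm)
      · refine (ih nu.card ?_ nu rfl).image _
        rw [← hn]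
        obtain ⟨c, hc⟩ := List.exists_mem_of_ne_nil r hr.ne_nil
        refine Finset.card_lt_card ⟨?_, fun h => ?_⟩
        · rw [hnu]; exact Finset.sdiff_subset
        · have := h (hr.mem c hc)
          rw [hnu] at this
          simp [hc] at this
    refine hfin.subset ?_
    intro rs hrs
    cases hrs with
    | nil => simp
    | cons h1 h2 h3 =>
      left
      simp only [Set.mem_iUnion]
      exact ⟨_, h1, _, h2, _, h3, rfl⟩

instance (lam : YoungDiagram) : Finite (SRHTabloid lam) := by
  have := (finite_isRimHookTabloid lam).to_subtype
  refine Finite.of_injective (β := {rs | IsRimHookTabloid lam rs})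
    (fun T => ⟨T.hooks, T.isRimHookTabloid⟩) fun T T' h => ?_
  exact SRHTabloid.ext (congrArg Subtype.val h)

instance {V : Type*} [PartialOrder V] (G : SimpleGraph V) (lam : YoungDiagram) :
    Finite (SRHGTabloid G lam) := by
  have : Finite {c : ℕ × ℕ // c ∈ lam} := Finite.of_fintype {c : ℕ × ℕ // c ∈ lam.cells}
  by_cases hV : Finite V
  · refine Finite.of_injective (β := SRHTabloid lam × ({c : ℕ × ℕ // c ∈ lam} ≃ V))
      (fun T => (T.toSRHTabloid, T.fill)) fun T T' h => ?_
    simp only [Prod.mk.injEq] at h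
    exact SRHGTabloid.ext (congrArg SRHTabloid.hooks h.1) h.2
  · have : IsEmpty (SRHGTabloid G lam) := ⟨fun T => hV (Finite.of_equiv _ T.fill)⟩
    infer_instance

instance {V : Type*} [PartialOrder V] (G : SimpleGraph V) (lam : YoungDiagram) :
    Fintype (SRHGTabloid G lam) := Fintype.ofFinite _

open Classical in
/-- The finite set of special rim hook `G`-tabloids of shape `lam` whose tail sequence is
non-increasing. -/
def nonIncreasingTailTabloids {V : Type*} [PartialOrder V] (G : SimpleGraph V)
    (lam : YoungDiagram) : Finset (SRHGTabloid G lam) :=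
  Finset.univ.filter fun T => NonIncreasing T.tailSeq

end SRH

end

/-! Both sides are compared with one determinant. Write `n` for a number of variables, δ for the
exponents (n-1, …, 0) and a_α for the alternant with exponents α.

On the algebraic side, the bialternant formula a_δ s_λ = a_{λ+δ} (`shiftedAlternant_mul_schurPoly`)
makes [s_λ] f the coefficient of x^{λ+δ} in a_δ f. For X_G, expand a_δ over permutations. A
coefficient of X_G counts colourings with prescribed class sizes, and the colour classes of an
incomparability graph are chains. So this coefficient is that of the squarefree monomial x_P in a
product of chain polynomials (`coeff_chromPoly`), and the signed sum is the coefficient of x_P in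
det(h_{λ_i-i+j}), where h_m is the sum over chains with m elements
(`coeff_shiftedAlternant_mul_chromPoly`).

On the combinatorial side, Laplace expansion along the last column turns this determinant into a
signed sum over special rim hook tabloids, each weighted by the product of h at its hook lengths
(`det_jacobiTrudi`). The coefficient of x_P in such a product counts the words in the vertices that
increase along each hook (`card_words_incBlocks`). These words are the fillings, so the result is
the signed number of all SRH `G`-tabloids.

The tail condition costs nothing. For a fixed word, let x, y be its first two letters, at the foot
of a tail of at least two cells. If x < y, the tabloids whose lowest hook is a single cell cancel
against those whose lowest hook is longer (`signedCount_cons_cons`). Hence only words with a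
non-increasing tail survive (`nonIncreasing_of_signedCount_ne_zero`).

Reading off coefficients shows that an expansion is unique and gives its value
(`IsSchurExpansion.apply_eq`). It exists because an antisymmetric polynomial is determined by its
coefficients at strictly decreasing exponents (`IsAntisymmetric.eq_zero`), and a_δ can be cancelled.
-/

noncomputable section
namespace SRH

/-! ### Chains of north and east steps -/

/-- Sequences of cells whose steps are north steps or east steps. -/
abbrev IsNEPath (r : List (ℕ × ℕ)) : Prop :=
  r.IsChain fun c d => NorthStep c d ∨ EastStep c d

/-- The content of a cell. -/
def content (c : ℕ × ℕ) : ℤ := (c.2 : ℤ) - c.1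

theorem IsNEPath.pairwise_content {r : List (ℕ × ℕ)} (h : IsNEPath r) :
    r.Pairwise fun c d => content c < content d := by
  have : IsTrans (ℕ × ℕ) fun c d => content c < content d :=
    ⟨fun _ _ _ h1 h2 => lt_trans h1 h2⟩
  refine List.IsChain.pairwise (h.imp ?_)
  intro c d hcd
  unfold NorthStep EastStep at hcd
  unfold content
  omega

theorem IsNEPath.pairwise_row {r : List (ℕ × ℕ)} (h : IsNEPath r) :
    r.Pairwise fun c d => d.1 ≤ c.1 := by
  have : IsTrans (ℕ × ℕ) fun c d => d.1 ≤ c.1 :=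
    ⟨fun _ _ _ h1 h2 => le_trans h2 h1⟩
  refine List.IsChain.pairwise (h.imp ?_)
  intro c d hcd
  unfold NorthStep EastStep at hcd
  omega

theorem IsNEPath.nodup {r : List (ℕ × ℕ)} (h : IsNEPath r) : r.Nodup :=
  h.pairwise_content.imp fun {c d} hcd e => by subst e; exact lt_irrefl _ hcd

theorem IsNEPath.eq_of_toFinset_eq {r s : List (ℕ × ℕ)} (hr : IsNEPath r) (hs : IsNEPath s)
    (h : r.toFinset = s.toFinset) : r = s := by
  refine (List.perm_of_nodup_nodup_toFinset_eq hr.nodup hs.nodup h).eq_of_pairwise ?_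
    hr.pairwise_content hs.pairwise_content
  intro a b _ _ h1 h2
  exact absurd (h1.trans h2) (lt_irrefl _)

/-- North and east steps both raise the content by exactly one. So the length of a path follows from
its two ends, and the path meets every diagonal between them. -/
theorem IsNEPath.content_getElem {r : List (ℕ × ℕ)} (h : IsNEPath r) (i : ℕ)
    (hi : i < r.length) : content r[i] = content (r[0]'(by omega)) + i := by
  induction i with
  | zero => simp
  | succ i ih =>
    have h1 := ih (by omega)
    have h2 := List.isChain_iff_getElem.1 h i (by omega)
    unfold NorthStep EastStep at h2
    unfold content at *
    push_cast
    omega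

/-- Only north steps change the row, so the sign of a hook depends only on the rows of its ends. -/
theorem IsNEPath.northSteps_add {r : List (ℕ × ℕ)} (h : IsNEPath r) (hne : r ≠ []) :
    northSteps r + (r.getLast hne).1 = (r.head hne).1 := by
  induction r with
  | nil => exact absurd rfl hne
  | cons c r ih =>
    cases r with
    | nil => simp [northSteps]
    | cons d r =>
      have h1 := ih (List.isChain_cons_cons.1 h).2 (by simp)
      have h2 := (List.isChain_cons_cons.1 h).1
      have h3 : northSteps (c :: d :: r) =
          northSteps (d :: r) + if NorthStep c d then 1 else 0 := by
        simp [northSteps, List.countP_cons]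
      rw [List.getLast_cons (by simp), h3]
      simp only [List.head_cons] at h1 ⊢
      split_ifs with h4
      · have := h4.1; omega
      · have := (h2.resolve_left h4).1; omega

/-! ### Removing the special rim hook that ends in a given row -/

/-- The diagram left when the boundary cells in the rows from row `a` on are removed. -/
def removeHook (lam : YoungDiagram) (a : ℕ) : YoungDiagram where
  cells := lam.cells.filter fun c => c.1 < a ∨ (c.1 + 1, c.2 + 1) ∈ lam
  isLowerSet := by
    rintro ⟨i, j⟩ ⟨i', j'⟩ hle hc
    simp only [Finset.coe_filter, YoungDiagram.mem_cells, Set.mem_ofPred_eq] at hc ⊢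
    obtain ⟨h1, h2⟩ := Prod.mk_le_mk.1 hle
    refine ⟨lam.up_left_mem h1 h2 hc.1, ?_⟩
    rcases hc.2 with h | h
    · exact Or.inl (lt_of_le_of_lt h1 h)
    · exact Or.inr (lam.up_left_mem (by omega) (by omega) h)

theorem mem_removeHook {lam : YoungDiagram} {a : ℕ} {c : ℕ × ℕ} :
    c ∈ removeHook lam a ↔ c ∈ lam ∧ (c.1 < a ∨ (c.1 + 1, c.2 + 1) ∈ lam) := by
  rw [← YoungDiagram.mem_cells]
  simp [removeHook]

theorem eq_rowLen_iff {lam : YoungDiagram} {i k : ℕ} (h : ∀ j, (i, j) ∈ lam ↔ j < k) :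
    lam.rowLen i = k := by
  apply le_antisymm
  · by_contra hlt
    exact absurd ((h k).1 (YoungDiagram.mem_iff_lt_rowLen.2 (not_le.1 hlt))) (lt_irrefl _)
  · by_contra hlt
    exact absurd (YoungDiagram.mem_iff_lt_rowLen.1 ((h _).2 (not_le.1 hlt))) (lt_irrefl _)

/-- Each row below row `a` loses one cell and moves up one place. Deleting row `a` and the last
column does the same to the Jacobi–Trudi matrix. -/
theorem rowLen_removeHook (lam : YoungDiagram) (a i : ℕ) :
    (removeHook lam a).rowLen i = if i < a then lam.rowLen i else lam.rowLen (i + 1) - 1 := by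
  refine eq_rowLen_iff fun j => ?_
  rw [mem_removeHook]
  simp only [YoungDiagram.mem_iff_lt_rowLen]
  have := lam.rowLen_anti i (i + 1) (by omega)
  split_ifs with h <;> omega

theorem rowLen_pos_iff {lam : YoungDiagram} {i : ℕ} : 0 < lam.rowLen i ↔ i < lam.colLen 0 := by
  rw [← YoungDiagram.mem_iff_lt_rowLen, YoungDiagram.mem_iff_lt_colLen]

theorem rowLen_eq_zero_iff {lam : YoungDiagram} {i : ℕ} :
    lam.rowLen i = 0 ↔ lam.colLen 0 ≤ i := by
  have := @rowLen_pos_iff lam i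
  omega

theorem colLen_removeHook_lt {lam : YoungDiagram} {a : ℕ} (ha : a < lam.colLen 0) :
    (removeHook lam a).colLen 0 < lam.colLen 0 := by
  have h : (removeHook lam a).rowLen (lam.colLen 0 - 1) = 0 := by
    rw [rowLen_removeHook, if_neg (by omega)]
    have : lam.rowLen (lam.colLen 0 - 1 + 1) = 0 := rowLen_eq_zero_iff.2 (by omega)
    omega
  have := rowLen_eq_zero_iff.1 h
  omega

/-- The hook is assembled upwards, with `k` counting rows from the bottom. The boundary cells of a
row begin in the column where the row below ends, so consecutive row segments are joined by a north
step. -/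
theorem exists_hook (lam : YoungDiagram) (k : ℕ) (hk : k < lam.colLen 0) :
    ∃ r : List (ℕ × ℕ), IsNEPath r ∧ r.head? = some (lam.colLen 0 - 1, 0) ∧
      r.getLast? = some (lam.colLen 0 - 1 - k, lam.rowLen (lam.colLen 0 - 1 - k) - 1) ∧
      ∀ c, c ∈ r ↔ c ∈ lam ∧ lam.colLen 0 - 1 - k ≤ c.1 ∧ (c.1 + 1, c.2 + 1) ∉ lam := by
  have seg : ∀ i, i < lam.colLen 0 → ∃ r : List (ℕ × ℕ), IsNEPath r ∧
      r.head? = some (i, lam.rowLen (i + 1) - 1) ∧ r.getLast? = some (i, lam.rowLen i - 1) ∧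
      ∀ c, c ∈ r ↔ c ∈ lam ∧ c.1 = i ∧ (c.1 + 1, c.2 + 1) ∉ lam := by
    intro i hi
    have h0 := rowLen_pos_iff.2 hi
    have h1 := lam.rowLen_anti i (i + 1) (by omega)
    -- For the lowest row the next row length is `0`, and truncated subtraction lets the segment
    -- start in column `0`.
    refine ⟨(List.range' (lam.rowLen (i + 1) - 1)
      (lam.rowLen i - (lam.rowLen (i + 1) - 1))).map fun j => (i, j), ?_, ?_, ?_, ?_⟩
    · rw [IsNEPath, List.isChain_map]
      refine (List.isChain_range' _ _ 1).imp ?_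
      intro a b hab
      exact Or.inr ⟨rfl, hab⟩
    · rw [List.head?_map, List.head?_range', if_neg (by omega)]; rfl
    · rw [List.getLast?_map, List.getLast?_range', if_neg (by omega)]
      simp only [Option.map_some, Option.some.injEq, Prod.mk.injEq, true_and]
      omega
    · rintro ⟨i', j⟩
      simp only [List.mem_map, List.mem_range'_1, Prod.mk.injEq, YoungDiagram.mem_iff_lt_rowLen]
      constructor
      · rintro ⟨j, hj, rfl, rfl⟩
        omega
      · rintro ⟨hj1, rfl, hj2⟩
        exact ⟨j, by omega, rfl, rfl⟩
  induction k with
  | zero =>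
    obtain ⟨r, h1, h2, h3, h4⟩ := seg (lam.colLen 0 - 1) (by omega)
    have h0 : lam.rowLen (lam.colLen 0 - 1 + 1) = 0 := rowLen_eq_zero_iff.2 (by omega)
    refine ⟨r, h1, by simpa [h0] using h2, by simpa using h3, ?_⟩
    rintro ⟨i, j⟩
    rw [h4]
    refine and_congr_right fun hc => and_congr_left fun _ => ?_
    have := YoungDiagram.mem_iff_lt_colLen.1 (lam.up_left_mem le_rfl (Nat.zero_le j) hc)
    simp only
    omega
  | succ k ih =>
    obtain ⟨r, h1, h2, h3, h4⟩ := ih (by omega)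
    obtain ⟨s, g1, g2, g3, g4⟩ := seg (lam.colLen 0 - 1 - (k + 1)) (by omega)
    refine ⟨r ++ s, ?_, ?_, ?_, ?_⟩
    · refine List.isChain_append.2 ⟨h1, g1, ?_⟩
      intro x hx y hy
      rw [h3, Option.mem_some_iff] at hx
      rw [g2, Option.mem_some_iff] at hy
      subst hx hy
      have : lam.colLen 0 - 1 - (k + 1) + 1 = lam.colLen 0 - 1 - k := by omega
      exact Or.inl ⟨by simp only; omega, by simp only [this]⟩
    · simp [h2]
    · simp [g3]
    · rintro ⟨i, j⟩
      rw [List.mem_append, h4, g4]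
      by_cases hc : (i, j) ∈ lam <;> by_cases hb : (i + 1, j + 1) ∈ lam <;> simp [hc, hb]
      omega

theorem exists_hook_of_row (lam : YoungDiagram) (a : Fin (lam.colLen 0)) :
    ∃ r : List (ℕ × ℕ), IsNEPath r ∧ r.head? = some (lam.colLen 0 - 1, 0) ∧
      r.getLast? = some ((a : ℕ), lam.rowLen a - 1) ∧
      ∀ c, c ∈ r ↔ c ∈ lam ∧ (a : ℕ) ≤ c.1 ∧ (c.1 + 1, c.2 + 1) ∉ lam := by
  have h := exists_hook lam (lam.colLen 0 - 1 - a) (by omega)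
  have ha := a.2
  rwa [show lam.colLen 0 - 1 - (lam.colLen 0 - 1 - a) = a by omega] at h

/-- The special rim hook of `lam` that ends in row `a`. -/
def hook (lam : YoungDiagram) (a : Fin (lam.colLen 0)) : List (ℕ × ℕ) :=
  (exists_hook_of_row lam a).choose

section hook
variable (lam : YoungDiagram) (a : Fin (lam.colLen 0))

theorem isNEPath_hook : IsNEPath (hook lam a) :=
  (exists_hook_of_row lam a).choose_spec.1

theorem head?_hook : (hook lam a).head? = some (lam.colLen 0 - 1, 0) :=
  (exists_hook_of_row lam a).choose_spec.2.1

theorem getLast?_hook : (hook lam a).getLast? = some ((a : ℕ), lam.rowLen a - 1) :=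
  (exists_hook_of_row lam a).choose_spec.2.2.1

theorem mem_hook {c : ℕ × ℕ} :
    c ∈ hook lam a ↔ c ∈ lam ∧ (a : ℕ) ≤ c.1 ∧ (c.1 + 1, c.2 + 1) ∉ lam :=
  (exists_hook_of_row lam a).choose_spec.2.2.2 c

theorem hook_ne_nil : hook lam a ≠ [] := by
  intro h
  have := head?_hook lam a
  simp [h] at this

theorem head_hook : (hook lam a).head (hook_ne_nil lam a) = (lam.colLen 0 - 1, 0) := by
  have := head?_hook lam a
  rwa [List.head?_eq_some_head (hook_ne_nil lam a), Option.some.injEq] at this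

theorem getLast_hook :
    (hook lam a).getLast (hook_ne_nil lam a) = ((a : ℕ), lam.rowLen a - 1) := by
  have := getLast?_hook lam a
  rwa [List.getLast?_eq_some_getLast (hook_ne_nil lam a), Option.some.injEq] at this

theorem northSteps_hook : northSteps (hook lam a) = lam.colLen 0 - 1 - a := by
  have h := (isNEPath_hook lam a).northSteps_add (hook_ne_nil lam a)
  rw [head_hook, getLast_hook] at h
  simp only at h
  omega

theorem length_hook : (hook lam a).length = lam.rowLen a + (lam.colLen 0 - 1 - a) := by
  have hpos := List.length_pos_of_ne_nil (hook_ne_nil lam a)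
  have h := (isNEPath_hook lam a).content_getElem ((hook lam a).length - 1) (by omega)
  rw [← List.getLast_eq_getElem (hook_ne_nil lam a), getLast_hook,
    ← List.head_eq_getElem (hook_ne_nil lam a), head_hook] at h
  have h0 := rowLen_pos_iff.2 a.2
  have ha := a.2
  unfold content at h
  simp only at h
  omega

theorem cells_removeHook :
    (removeHook lam a).cells = lam.cells \ (hook lam a).toFinset := by
  ext c
  rw [YoungDiagram.mem_cells, mem_removeHook, Finset.mem_sdiff, List.mem_toFinset, mem_hook,
    YoungDiagram.mem_cells]
  by_cases h : c ∈ lam <;> by_cases h' : (c.1 + 1, c.2 + 1) ∈ lam <;> simp [h, h']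

theorem isRimHook_hook : IsRimHook lam (hook lam a) where
  ne_nil := hook_ne_nil lam a
  connected := isNEPath_hook lam a
  mem c hc := ((mem_hook lam a).1 hc).1
  boundary c hc := ((mem_hook lam a).1 hc).2.2
  removable := by
    rw [← cells_removeHook]
    exact (removeHook lam a).isLowerSet

theorem hook_special : ∃ c ∈ hook lam a, c.2 = 0 :=
  ⟨_, List.mem_of_mem_head? (head?_hook lam a), rfl⟩

end hook

theorem hook_injective (lam : YoungDiagram) : Function.Injective (hook lam) := by
  intro a b h
  have h1 := getLast?_hook lam a
  rw [h, getLast?_hook lam b] at h1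
  simp only [Option.some.injEq, Prod.mk.injEq] at h1
  exact Fin.ext h1.1.symm

theorem IsNEPath.exists_content {r : List (ℕ × ℕ)} (h : IsNEPath r) (hne : r ≠ []) {x : ℤ}
    (h1 : content (r.head hne) ≤ x) (h2 : x ≤ content (r.getLast hne)) :
    ∃ c ∈ r, content c = x := by
  have hpos := List.length_pos_of_ne_nil hne
  have h3 := h.content_getElem (r.length - 1) (by omega)
  rw [List.getLast_eq_getElem] at h2
  rw [List.head_eq_getElem] at h1
  refine ⟨r[(x - content r[0]).toNat]'(by omega), List.getElem_mem _, ?_⟩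
  rw [h.content_getElem]
  omega

/-- Of two distinct cells on one diagonal, the upper one has its southeast neighbour weakly
northwest of the lower one, hence in the diagram. So a diagonal has at most one boundary cell. -/
theorem eq_of_content_eq {lam : YoungDiagram} {c d : ℕ × ℕ} (hc : c ∈ lam) (hd : d ∈ lam)
    (hc' : (c.1 + 1, c.2 + 1) ∉ lam) (hd' : (d.1 + 1, d.2 + 1) ∉ lam)
    (h : content c = content d) : c = d := by
  unfold content at h
  rcases lt_trichotomy c.1 d.1 with h1 | h1 | h1
  · exact absurd (lam.up_left_mem (show c.1 + 1 ≤ d.1 by omega) (show c.2 + 1 ≤ d.2 by omega) hd)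
      hc'
  · exact Prod.ext h1 (by omega)
  · exact absurd (lam.up_left_mem (show d.1 + 1 ≤ c.1 by omega) (show d.2 + 1 ≤ c.2 by omega) hc)
      hd'

theorem content_corner_le {lam : YoungDiagram} {c : ℕ × ℕ} (hc : c ∈ lam) :
    content (lam.colLen 0 - 1, 0) ≤ content c := by
  have := YoungDiagram.mem_iff_lt_colLen.1 (lam.up_left_mem le_rfl (Nat.zero_le c.2) hc)
  unfold content
  simp only
  omega

/-- A special rim hook is determined by the row in which it ends. It contains the lowest cell of the
first column, and its last cell is the end of a row. Any boundary cell not above that row has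
content between those of the two ends, so the path has a cell on the same diagonal, and the two
cells coincide. -/
theorem exists_eq_hook {lam : YoungDiagram} {r : List (ℕ × ℕ)} (h : IsRimHook lam r)
    (hsp : ∃ c ∈ r, c.2 = 0) : ∃ a, r = hook lam a := by
  have hpath : IsNEPath r := h.connected
  -- What remains is a lower set, so the hook is closed towards the southeast inside `lam`.
  have removed : ∀ c d : ℕ × ℕ, c ≤ d → c ∈ r → d ∈ lam → d ∈ r := by
    intro c d hcd hc hd
    by_contra hdr
    have hd' : d ∈ ((lam.cells \ r.toFinset : Finset (ℕ × ℕ)) : Set (ℕ × ℕ)) := by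
      simp [hd, hdr]
    have := h.removable hcd hd'
    simp [hc] at this
  have hne := h.ne_nil
  obtain ⟨l, hl_def⟩ : ∃ l, l = r.getLast hne := ⟨_, rfl⟩
  have hlr : l ∈ r := hl_def ▸ List.getLast_mem hne
  have hl := h.mem _ hlr
  obtain ⟨⟨i, j⟩, hij, hj⟩ := hsp
  simp only at hj
  subst hj
  have hi := YoungDiagram.mem_iff_lt_colLen.1 (h.mem _ hij)
  have hcorner : (lam.colLen 0 - 1, 0) ∈ r :=
    removed (i, 0) _ (Prod.mk_le_mk.2 ⟨by omega, le_rfl⟩) hij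
      (YoungDiagram.mem_iff_lt_colLen.2 (by omega))
  have hhead : content (r.head hne) ≤ content (lam.colLen 0 - 1, 0) := by
    obtain ⟨k, hk, he⟩ := List.getElem_of_mem hcorner
    rw [← he, hpath.content_getElem, List.head_eq_getElem]
    omega
  have hlast : ∀ c ∈ r, content c ≤ content l := by
    intro c hc
    obtain ⟨k, hk, rfl⟩ := List.getElem_of_mem hc
    rw [hl_def, List.getLast_eq_getElem, hpath.content_getElem k,
      hpath.content_getElem (r.length - 1) (by omega)]
    omega
  have hrow : ∀ c ∈ r, l.1 ≤ c.1 := by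
    intro c hc
    have hp := hpath.pairwise_row
    rw [← List.dropLast_append_getLast hne] at hc hp
    rcases List.mem_append.1 hc with hc | hc
    · exact (List.pairwise_append.1 hp).2.2 c hc _ (by simp [hl_def])
    · rw [List.mem_singleton.1 hc, hl_def]
  have hend : (l.1, l.2 + 1) ∉ lam := by
    intro hmem
    have := hlast _ (removed l _ (Prod.mk_le_mk.2 ⟨le_rfl, Nat.le_succ _⟩) hlr hmem)
    unfold content at this
    simp only at this
    push_cast at this
    omega
  have hl1 : l.1 < lam.colLen 0 :=
    YoungDiagram.mem_iff_lt_colLen.1 (lam.up_left_mem le_rfl (Nat.zero_le l.2) hl)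
  refine ⟨⟨l.1, hl1⟩, hpath.eq_of_toFinset_eq (isNEPath_hook _ _) ?_⟩
  ext c
  rw [List.mem_toFinset, List.mem_toFinset, mem_hook]
  constructor
  · intro hc
    exact ⟨h.mem c hc, hrow c hc, h.boundary c hc⟩
  · rintro ⟨hc, hc1, hc2⟩
    have hcl : content c ≤ content l := by
      rw [YoungDiagram.mem_iff_lt_rowLen] at hend
      have h1 := YoungDiagram.mem_iff_lt_rowLen.1 hc
      have h2 := lam.rowLen_anti _ _ hc1
      have h3 : l.1 ≤ c.1 := hc1
      simp only at h2
      unfold content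
      omega
    obtain ⟨d, hd, hdc⟩ := hpath.exists_content hne (hhead.trans (content_corner_le hc)) (hl_def ▸ hcl)
    rwa [← eq_of_content_eq (h.mem d hd) hc (h.boundary d hd) hc2 hdc]

/-! ### Special rim hook tabloids by their lowest hook -/

instance (lam : YoungDiagram) : Fintype (SRHTabloid lam) := Fintype.ofFinite _

/-- Add a lowest hook to a special rim hook tabloid. -/
def SRHTabloid.cons (lam : YoungDiagram) (a : Fin (lam.colLen 0))
    (T : SRHTabloid (removeHook lam a)) : SRHTabloid lam where
  hooks := hook lam a :: T.hooks
  isRimHookTabloid := .cons (isRimHook_hook lam a) (cells_removeHook lam a) T.isRimHookTabloid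
  special := by
    rw [List.forall_mem_cons]
    exact ⟨hook_special lam a, T.special⟩

theorem SRHTabloid.cons_bijective {lam : YoungDiagram} (hlam : lam ≠ ⊥) :
    Function.Bijective fun p : (a : Fin (lam.colLen 0)) × SRHTabloid (removeHook lam a) =>
      SRHTabloid.cons lam p.1 p.2 := by
  constructor
  · rintro ⟨a, T⟩ ⟨b, S⟩ h
    have h1 : hook lam a :: T.hooks = hook lam b :: S.hooks := congrArg SRHTabloid.hooks h
    rw [List.cons.injEq] at h1
    obtain rfl := hook_injective lam h1.1
    obtain rfl := SRHTabloid.ext h1.2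
    rfl
  · rintro ⟨hooks, h1, h2⟩
    cases h1 with
    | nil => exact absurd rfl hlam
    | cons g1 g2 g3 =>
      rw [List.forall_mem_cons] at h2
      obtain ⟨a, rfl⟩ := exists_eq_hook g1 h2.1
      rw [← cells_removeHook] at g2
      obtain rfl := YoungDiagram.ext g2
      exact ⟨⟨a, ⟨_, g3, h2.2⟩⟩, rfl⟩

theorem SRHTabloid.sum_eq {M : Type*} [AddCommMonoid M] {lam : YoungDiagram} (hlam : lam ≠ ⊥)
    (f : SRHTabloid lam → M) :
    ∑ T, f T = ∑ a : Fin (lam.colLen 0), ∑ T : SRHTabloid (removeHook lam a), f (SRHTabloid.cons lam a T) := by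
  rw [← Fintype.sum_sigma' fun a T => f (SRHTabloid.cons lam a T)]
  exact (Function.Bijective.sum_comp (SRHTabloid.cons_bijective hlam) f).symm

theorem SRHTabloid.sgn_cons (lam : YoungDiagram) (a : Fin (lam.colLen 0))
    (T : SRHTabloid (removeHook lam a)) :
    (SRHTabloid.cons lam a T).sgn = (-1) ^ (lam.colLen 0 - 1 - a) * T.sgn := by
  simp [SRHTabloid.sgn, SRHTabloid.cons, northSteps_hook, pow_add]

theorem eq_bot_iff_colLen {lam : YoungDiagram} : lam = ⊥ ↔ lam.colLen 0 = 0 := by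
  constructor
  · rintro rfl
    by_contra h
    exact YoungDiagram.notMem_bot (0, 0) (YoungDiagram.mem_iff_lt_colLen.2 (Nat.pos_of_ne_zero h))
  · intro h
    refine YoungDiagram.ext (Finset.eq_empty_of_forall_notMem ?_)
    rintro ⟨i, j⟩ hc
    have := YoungDiagram.mem_iff_lt_colLen.1 (lam.up_left_mem le_rfl (Nat.zero_le j) hc)
    omega

theorem SRHTabloid.hooks_bot (T : SRHTabloid ⊥) : T.hooks = [] := by
  obtain ⟨hooks, h1, h2⟩ := T
  cases h1 with
  | nil => rfl
  | cons g1 g2 g3 =>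
    obtain ⟨c, hc⟩ := List.exists_mem_of_ne_nil _ g1.ne_nil
    exact absurd (g1.mem c hc) (YoungDiagram.notMem_bot c)

theorem SRHTabloid.sum_bot {M : Type*} [AddCommMonoid M] (f : SRHTabloid ⊥ → M) :
    ∑ T, f T = f ⟨[], .nil, by simp⟩ := by
  refine Fintype.sum_eq_single _ fun T hT => absurd ?_ hT
  exact SRHTabloid.ext T.hooks_bot

/-! ### The Jacobi–Trudi determinant as a sum over special rim hook tabloids -/

/-- The matrix with entries `h (μ i - i + j)`, where `h` vanishes at negative numbers. -/
def jacobiTrudi {R : Type*} [CommRing R] (h : ℕ → R) (μ : ℕ → ℕ) (n : ℕ) :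
    Matrix (Fin n) (Fin n) R :=
  Matrix.of fun i j => if (i : ℕ) ≤ μ i + j then h (μ i + j - i) else 0

theorem succAbove_val {n : ℕ} (a : Fin (n + 1)) (i : Fin n) :
    (a.succAbove i : ℕ) = if (i : ℕ) < a then (i : ℕ) else i + 1 := by
  unfold Fin.succAbove
  simp only [Fin.lt_def, Fin.val_castSucc]
  split_ifs <;> simp

/-- Expanding along the last column amounts to choosing the row in which the lowest hook ends. The
entry is `h` at the length of that hook, and the minor is the matrix of the diagram left after its
removal. Allowing `n` larger than the number of rows keeps the induction going, since removing a
hook can delete several rows. -/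
theorem det_jacobiTrudi {R : Type*} [CommRing R] (h : ℕ → R) (h0 : h 0 = 1) (n : ℕ)
    (lam : YoungDiagram) (hn : lam.colLen 0 ≤ n) :
    (jacobiTrudi h lam.rowLen n).det =
      ∑ T : SRHTabloid lam, (T.sgn : R) * (T.hooks.map fun r => h r.length).prod := by
  induction n generalizing lam with
  | zero =>
    obtain rfl := eq_bot_iff_colLen.2 (Nat.le_zero.1 hn)
    rw [SRHTabloid.sum_bot]
    simp [SRHTabloid.sgn]
  | succ n ih =>
    rcases Nat.lt_or_ge (lam.colLen 0) (n + 1) with hlt | hge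
    -- The last row belongs to an empty row of the diagram and reads (0, …, 0, 1), because `h 0 =
    -- 1`.
    · rw [← ih lam (by omega), Matrix.det_succ_row _ (Fin.last n), Finset.sum_eq_single (Fin.last n)]
      · have hz : lam.rowLen n = 0 := rowLen_eq_zero_iff.2 (by omega)
        have : (jacobiTrudi h lam.rowLen (n + 1)).submatrix (Fin.last n).succAbove
            (Fin.last n).succAbove = jacobiTrudi h lam.rowLen n := by
          ext i j
          simp [jacobiTrudi]
        rw [this]
        simp [jacobiTrudi, hz, h0, ← two_mul]
      · intro j _ hj
        have hz : lam.rowLen n = 0 := rowLen_eq_zero_iff.2 (by omega)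
        have hj' : ¬ n ≤ (j : ℕ) := fun hle => hj (Fin.ext (by simp; omega))
        simp [jacobiTrudi, hz, hj']
      · simp
    · have hl : lam.colLen 0 = n + 1 := le_antisymm hn hge
      have hlam : lam ≠ ⊥ := fun e => by rw [eq_bot_iff_colLen] at e; omega
      rw [SRHTabloid.sum_eq hlam, Matrix.det_succ_column _ (Fin.last n),
        ← Equiv.sum_comp (finCongr hl)]
      refine Finset.sum_congr rfl fun a _ => ?_
      have ha := a.2
      have hsub : (jacobiTrudi h lam.rowLen (n + 1)).submatrix (finCongr hl a).succAbove
          (Fin.last n).succAbove = jacobiTrudi h (removeHook lam a).rowLen n := by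
        ext i j
        -- Positivity makes the truncated `lam.rowLen (i + 1) - 1` an honest difference.
        have hi : 0 < lam.rowLen (i + 1) := rowLen_pos_iff.2 (by omega)
        simp only [jacobiTrudi, Matrix.submatrix_apply, Matrix.of_apply, rowLen_removeHook,
          succAbove_val, finCongr_apply, Fin.val_cast, Fin.val_last]
        have e1 : (j : ℕ) < n := j.2
        simp only [e1, if_true]
        by_cases hia : (i : ℕ) < a
        · simp only [hia, if_true]
        · simp only [hia, if_false]
          have e2 : ((i : ℕ) + 1 ≤ lam.rowLen (i + 1) + j) ↔ (i : ℕ) ≤ lam.rowLen (i + 1) - 1 + j := by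
            omega
          have e3 : lam.rowLen (i + 1) + j - (i + 1) = lam.rowLen (i + 1) - 1 + j - i := by omega
          simp only [e2, e3]
      rw [hsub, ih _ (by have := colLen_removeHook_lt ha; omega), Finset.mul_sum]
      refine Finset.sum_congr rfl fun T _ => ?_
      -- The Laplace sign has the parity of the number `n - a` of north steps.
      have hs : (-1 : R) ^ (((finCongr hl a : Fin (n + 1)) : ℕ) + (Fin.last n : ℕ)) =
          (-1) ^ (lam.colLen 0 - 1 - a) := by
        simp only [finCongr_apply, Fin.val_cast, Fin.val_last]
        rw [show (a : ℕ) + n = (lam.colLen 0 - 1 - a) + 2 * a by omega, pow_add, pow_mul]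
        simp
      have he : jacobiTrudi h lam.rowLen (n + 1) (finCongr hl a) (Fin.last n) =
          h (hook lam a).length := by
        simp only [jacobiTrudi, Matrix.of_apply, finCongr_apply, Fin.val_cast, Fin.val_last]
        rw [if_pos (by omega), length_hook]
        congr 1
        omega
      rw [hs, he, SRHTabloid.sgn_cons]
      simp only [SRHTabloid.cons, List.map_cons, List.prod_cons, Int.cast_mul, Int.cast_pow,
        Int.cast_neg, Int.cast_one]
      ring

/-! ### Words cut into increasing blocks -/

section words
variable {P : Type*} [PartialOrder P]

/-- The word `w` is a concatenation of strictly increasing blocks of the lengths `ms`. -/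
def IncBlocks : List ℕ → List P → Prop
  | [], w => w = []
  | m :: ms, w => (m ≤ w.length ∧ (w.take m).Pairwise (· < ·)) ∧ IncBlocks ms (w.drop m)

theorem IncBlocks.length_eq {ms : List ℕ} {w : List P} (h : IncBlocks ms w) :
    w.length = ms.sum := by
  induction ms generalizing w with
  | nil => rw [show w = [] from h]; rfl
  | cons m ms ih =>
    have h1 := ih h.2
    have h2 := h.1.1
    rw [List.length_drop] at h1
    rw [List.sum_cons]
    omega

theorem incBlocks_pmap_flatten {α : Type*} {q : α → Prop} (g : ∀ a, q a → P) (L : List (List α))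
    (H : ∀ c ∈ L.flatten, q c) :
    IncBlocks (L.map List.length) (L.flatten.pmap g H) ↔
      ∀ r ∈ L, r.Pairwise fun c d => ∀ hc hd, g c hc < g d hd := by
  induction L with
  | nil => simp [IncBlocks]
  | cons r L ih =>
    have e : (r :: L).flatten.pmap g H = r.pmap g (fun c hc => H c (by simp [hc])) ++
        L.flatten.pmap g (fun c hc => H c (by
          rw [List.flatten_cons, List.mem_append]; exact Or.inr hc)) := by
      simp only [List.flatten_cons, List.pmap_append]
    rw [e, List.map_cons, IncBlocks, List.forall_mem_cons,
      List.drop_left' (by simp), List.take_left' (by simp), ih, List.pairwise_pmap]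
    simp

open Classical in
/-- The signed number of special rim hook tabloids of shape `lam` whose rim hooks, filled with the
word `w`, are increasing. -/
def signedCount (lam : YoungDiagram) (w : List P) : ℚ :=
  ∑ T : SRHTabloid lam, if IncBlocks (T.hooks.map List.length) w then (T.sgn : ℚ) else 0

open Classical in
theorem signedCount_eq {lam : YoungDiagram} (hlam : lam ≠ ⊥) (w : List P) :
    signedCount lam w = ∑ a : Fin (lam.colLen 0),
      if lam.rowLen a + (lam.colLen 0 - 1 - a) ≤ w.length ∧
          (w.take (lam.rowLen a + (lam.colLen 0 - 1 - a))).Pairwise (· < ·) then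
        (-1) ^ (lam.colLen 0 - 1 - a) *
          signedCount (removeHook lam a) (w.drop (lam.rowLen a + (lam.colLen 0 - 1 - a)))
      else 0 := by
  unfold signedCount
  rw [SRHTabloid.sum_eq hlam]
  refine Finset.sum_congr rfl fun a _ => ?_
  have key : ∀ T : SRHTabloid (removeHook lam a),
      IncBlocks ((SRHTabloid.cons lam a T).hooks.map List.length) w ↔
      (lam.rowLen a + (lam.colLen 0 - 1 - a) ≤ w.length ∧
          (w.take (lam.rowLen a + (lam.colLen 0 - 1 - a))).Pairwise (· < ·)) ∧
      IncBlocks (T.hooks.map List.length)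
        (w.drop (lam.rowLen a + (lam.colLen 0 - 1 - a))) := by
    intro T
    rw [SRHTabloid.cons, List.map_cons, IncBlocks, length_hook]
  simp only [key, SRHTabloid.sgn_cons]
  split_ifs with h
  · rw [Finset.mul_sum]
    refine Finset.sum_congr rfl fun T _ => ?_
    simp only [h, true_and, and_self]
    split_ifs <;> simp
  · exact Finset.sum_eq_zero fun T _ => if_neg fun h' => h h'.1

theorem colLen_removeHook_last {lam : YoungDiagram} (h : lam.rowLen (lam.colLen 0 - 1) = 1) :
    (removeHook lam (lam.colLen 0 - 1)).colLen 0 = lam.colLen 0 - 1 := by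
  have h0 : 0 < lam.colLen 0 := by
    by_contra h0
    have := rowLen_eq_zero_iff (lam := lam) (i := lam.colLen 0 - 1) |>.2 (by omega)
    omega
  have h1 := colLen_removeHook_lt (lam := lam) (a := lam.colLen 0 - 1) (by omega)
  by_contra h2
  have h3 : (removeHook lam (lam.colLen 0 - 1)).rowLen (lam.colLen 0 - 2) = 0 :=
    rowLen_eq_zero_iff.2 (by omega)
  rw [rowLen_removeHook, if_pos (by omega), rowLen_eq_zero_iff] at h3
  omega

theorem removeHook_removeHook_last {lam : YoungDiagram}
    (h : lam.rowLen (lam.colLen 0 - 1) = 1) {a : ℕ} (ha : a < lam.colLen 0 - 1) :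
    removeHook (removeHook lam (lam.colLen 0 - 1)) a = removeHook lam a := by
  have key : ∀ i j, (i, j) ∈ removeHook (removeHook lam (lam.colLen 0 - 1)) a ↔
      (i, j) ∈ removeHook lam a := by
    intro i j
    simp only [YoungDiagram.mem_iff_lt_rowLen, rowLen_removeHook]
    have h2 : lam.rowLen (lam.colLen 0) = 0 := rowLen_eq_zero_iff.2 le_rfl
    split_ifs with h1 h3 h4
    · rfl
    · omega
    · rfl
    · have h5 : lam.rowLen (i + 1 + 1) ≤ lam.rowLen (lam.colLen 0) :=
        lam.rowLen_anti _ _ (by omega)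
      have h6 : lam.rowLen (i + 1) ≤ lam.rowLen (lam.colLen 0 - 1) :=
        lam.rowLen_anti _ _ (by omega)
      omega
  refine YoungDiagram.ext (Finset.ext ?_)
  rintro ⟨i, j⟩
  simpa only [YoungDiagram.mem_cells] using key i j

theorem pairwise_lt_take_cons_cons {x y : P} {w : List P} {m : ℕ} (hm : 0 < m) :
    ((x :: y :: w).take (m + 1)).Pairwise (· < ·) ↔
      x < y ∧ ((y :: w).take m).Pairwise (· < ·) := by
  obtain ⟨m, rfl⟩ : ∃ k, m = k + 1 := ⟨m - 1, by omega⟩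
  simp only [List.take_succ_cons, List.pairwise_cons, List.mem_cons, forall_eq_or_imp]
  constructor
  · rintro ⟨⟨h1, h2⟩, h3, h4⟩
    exact ⟨h1, h3, h4⟩
  · rintro ⟨h1, h3, h4⟩
    exact ⟨⟨h1, fun a ha => h1.trans (h3 a ha)⟩, h3, h4⟩

open Classical in
-- This is the sign-reversing cancellation. Either the lowest hook is the single bottom cell, and
-- the rest is a tabloid of the smaller shape. Or it continues upwards, which forces x < y; then
-- deleting its first cell gives a tabloid of the smaller shape with one north step fewer, hence of
-- opposite sign. The two contributions cancel when x < y, and only the first is present otherwise.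
theorem signedCount_cons_cons {lam : YoungDiagram} (hl : 2 ≤ lam.colLen 0)
    (h : lam.rowLen (lam.colLen 0 - 1) = 1) (x y : P) (w : List P) :
    signedCount lam (x :: y :: w) =
      (if x < y then 0 else 1) * signedCount (removeHook lam (lam.colLen 0 - 1)) (y :: w) := by
  obtain ⟨l, hl'⟩ : ∃ l, lam.colLen 0 = l + 2 := ⟨lam.colLen 0 - 2, by omega⟩
  have hlam : lam ≠ ⊥ := fun e => by rw [eq_bot_iff_colLen] at e; omega
  set nu := removeHook lam (lam.colLen 0 - 1) with hnu
  have hnul : nu.colLen 0 = l + 1 := by rw [hnu, colLen_removeHook_last h]; omega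
  have hnu0 : nu ≠ ⊥ := fun e => by rw [eq_bot_iff_colLen] at e; omega
  have hlast : lam.colLen 0 - 1 = l + 1 := by omega
  rw [signedCount_eq hlam, ← Equiv.sum_comp (finCongr hl').symm, Fin.sum_univ_castSucc]
  simp only [finCongr_symm, finCongr_apply, Fin.val_cast, Fin.val_castSucc, Fin.val_last, hlast]
  rw [hlast] at h hnu
  -- Lowest hooks that end above the last row.
  have hrest : ∑ a : Fin (l + 1), (if lam.rowLen a + (l + 1 - a) ≤ (x :: y :: w).length ∧
      ((x :: y :: w).take (lam.rowLen a + (l + 1 - a))).Pairwise (· < ·) then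
        (-1 : ℚ) ^ (l + 1 - (a : ℕ)) *
          signedCount (removeHook lam a) ((x :: y :: w).drop (lam.rowLen a + (l + 1 - a)))
      else 0) = (if x < y then -1 else 0) * signedCount nu (y :: w) := by
    rw [signedCount_eq hnu0, ← Equiv.sum_comp (finCongr hnul).symm, Finset.mul_sum]
    refine Finset.sum_congr rfl fun a _ => ?_
    have ha := a.2
    have hpos : 0 < lam.rowLen a := rowLen_pos_iff.2 (by omega)
    simp only [finCongr_symm, finCongr_apply, Fin.val_cast, hnul]
    have e1 : nu.rowLen a = lam.rowLen a := by rw [hnu, rowLen_removeHook, if_pos ha]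
    have e2 : removeHook nu a = removeHook lam a :=
      removeHook_removeHook_last (lam := lam) (by rw [hlast]; exact h) (by omega)
    rw [e1, e2, show lam.rowLen a + (l + 1 - a) = (lam.rowLen a + (l + 1 - 1 - a)) + 1 by omega,
      List.drop_succ_cons, show l + 1 - (a : ℕ) = (l + 1 - 1 - a) + 1 by omega, pow_succ]
    have hm : 0 < lam.rowLen a + (l + 1 - 1 - a) := by omega
    simp only [List.length_cons, Nat.add_le_add_iff_right, pairwise_lt_take_cons_cons hm]
    by_cases hxy : x < y
    · simp only [hxy, true_and, if_true]
      split_ifs <;> ring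
    · simp [hxy]
  rw [hrest, h, ← hnu]
  simp only [Nat.sub_self, Nat.add_zero]
  simp only [List.length_cons, List.take_succ_cons, List.take_zero, List.drop_succ_cons,
    List.drop_zero, List.pairwise_singleton, pow_zero, one_mul]
  have hlen : 1 ≤ w.length + 1 + 1 := by omega
  simp only [hlen, true_and, if_true]
  split_ifs <;> ring

theorem colLen_removeHook_le (lam : YoungDiagram) (a j : ℕ) :
    (removeHook lam a).colLen j ≤ lam.colLen j := by
  by_contra hlt
  rw [not_le] at hlt
  have h := (mem_removeHook.1 (YoungDiagram.mem_iff_lt_colLen.2 hlt)).1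
  exact absurd (YoungDiagram.mem_iff_lt_colLen.1 h) (lt_irrefl _)

theorem rowLen_eq_one_iff {lam : YoungDiagram} {i : ℕ} :
    lam.rowLen i = 1 ↔ lam.colLen 1 ≤ i ∧ i < lam.colLen 0 := by
  have h1 : 1 < lam.rowLen i ↔ i < lam.colLen 1 := by
    rw [← YoungDiagram.mem_iff_lt_rowLen, YoungDiagram.mem_iff_lt_colLen]
  have h2 := @rowLen_pos_iff lam i
  omega

/-- The cancellation is iterated along the tail, whose length is the difference of the first two
column lengths. Distinctness of the letters turns "not less" into "not less or equal". -/
theorem nonIncreasing_of_signedCount_ne_zero {lam : YoungDiagram} {w : List P} (hw : w.Nodup)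
    (h : signedCount lam w ≠ 0) : NonIncreasing (w.take (lam.colLen 0 - lam.colLen 1)) := by
  induction hk : lam.colLen 0 - lam.colLen 1 generalizing lam w with
  | zero => simp [NonIncreasing]
  | succ k ih =>
    match w, k with
    | [], _ => simp [NonIncreasing]
    | [x], _ => simp [NonIncreasing]
    | x :: y :: w, 0 => simp [NonIncreasing]
    | x :: y :: w, k + 1 =>
      have hrow : lam.rowLen (lam.colLen 0 - 1) = 1 := rowLen_eq_one_iff.2 (by omega)
      rw [signedCount_cons_cons (by omega) hrow] at h
      have hxy : ¬ x < y := fun hlt => h (by simp [hlt])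
      have hcol : (removeHook lam (lam.colLen 0 - 1)).colLen 1 = lam.colLen 1 := by
        refine le_antisymm (colLen_removeHook_le _ _ _) ?_
        by_contra hlt
        rw [not_le] at hlt
        have := YoungDiagram.mem_iff_lt_colLen.2 hlt
        refine absurd ?_ (lt_irrefl ((removeHook lam (lam.colLen 0 - 1)).colLen 1))
        rw [← YoungDiagram.mem_iff_lt_colLen, mem_removeHook]
        exact ⟨this, Or.inl (by simp only; omega)⟩
      have h2 := ih (List.nodup_cons.1 hw).2 (right_ne_zero_of_mul h)
        (by rw [colLen_removeHook_last hrow, hcol]; omega)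
      have hne : x ≠ y := fun e => (List.nodup_cons.1 hw).1 (by simp [e])
      rw [List.take_succ_cons] at h2 ⊢
      rw [List.take_succ_cons]
      exact List.isChain_cons_cons.2 ⟨fun hle => hxy (lt_of_le_of_ne hle hne), h2⟩

end words

/-! ### Special rim hook `G`-tabloids as words -/

theorem IsRimHookTabloid.flatten {lam : YoungDiagram} {hs : List (List (ℕ × ℕ))}
    (h : IsRimHookTabloid lam hs) : hs.flatten.Nodup ∧ ∀ c, c ∈ hs.flatten ↔ c ∈ lam := by
  induction h with
  | nil => simp [YoungDiagram.notMem_bot]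
  | @cons lam nu r rs h1 h2 _ ih =>
    have hmem : ∀ c, c ∈ nu ↔ c ∈ lam ∧ c ∉ r := by
      intro c
      rw [← YoungDiagram.mem_cells, h2]
      simp
    constructor
    · rw [List.flatten_cons, List.nodup_append]
      refine ⟨IsNEPath.nodup h1.connected, ih.1, ?_⟩
      rintro c hc _ hd rfl
      exact ((hmem c).1 ((ih.2 c).1 hd)).2 hc
    · intro c
      rw [List.flatten_cons, List.mem_append, ih.2, hmem]
      have := h1.mem c
      tauto

/-- Whatever the tabloid, its hooks run through the tail cells first, from bottom to top: a hook
starting in the tail goes straight north until it ends or leaves the tail. So the tail sequence is a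
prefix of the word and depends on the word alone. -/
theorem SRHTabloid.flatten_getElem? {lam : YoungDiagram} (T : SRHTabloid lam) {i : ℕ}
    (hi : i < lam.colLen 0 - lam.colLen 1) :
    T.hooks.flatten[i]? = some (lam.colLen 0 - 1 - i, 0) := by
  induction hn : lam.colLen 0 using Nat.strong_induction_on generalizing lam i with
  | _ n ih =>
    have hlam : lam ≠ ⊥ := fun e => by rw [eq_bot_iff_colLen] at e; omega
    obtain ⟨⟨a, S⟩, rfl⟩ := (SRHTabloid.cons_bijective hlam).2 T
    have ha := a.2
    simp only [SRHTabloid.cons, List.flatten_cons]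
    rcases Nat.lt_or_ge i (hook lam a).length with hlt | hge
    · rw [List.getElem?_append_left hlt, List.getElem?_eq_getElem hlt, Option.some.injEq]
      have hc := (mem_hook lam a).1 (List.getElem_mem hlt)
      refine eq_of_content_eq hc.1 (YoungDiagram.mem_iff_lt_colLen.2 (by omega)) hc.2.2 ?_ ?_
      · rw [YoungDiagram.mem_iff_lt_colLen]
        simp only [Nat.zero_add]
        omega
      · rw [(isNEPath_hook lam a).content_getElem, ← List.head_eq_getElem (hook_ne_nil lam a),
          head_hook]
        unfold content
        simp only
        omega
    · rw [List.getElem?_append_right hge]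
      rw [length_hook] at hge ⊢
      -- The lowest hook is no longer than `i`, so it ends inside the tail. It is then a vertical
      -- strip, and its removal leaves exactly `a` rows.
      have h1 : lam.rowLen a = 1 := by
        have h0 := rowLen_pos_iff.2 ha
        exact rowLen_eq_one_iff.2 ⟨by omega, ha⟩
      have h2 : (removeHook lam a).colLen 0 = a := by
        apply le_antisymm
        · rw [← rowLen_eq_zero_iff, rowLen_removeHook, if_neg (lt_irrefl _)]
          have := lam.rowLen_anti a (a + 1) (by omega)
          omega
        · by_contra hlt
          have h3 : (removeHook lam a).rowLen (a - 1) = 0 := rowLen_eq_zero_iff.2 (by omega)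
          rw [rowLen_removeHook, if_pos (by omega), rowLen_eq_zero_iff] at h3
          omega
      have h4 := colLen_removeHook_le lam a 1
      rw [ih _ (by omega) S (by omega) h2]
      congr 2
      omega

section words
variable {P : Type*} [PartialOrder P] {G : SimpleGraph P} {lam : YoungDiagram}

/-- The word of the vertices in the rim hooks of a tabloid, hook by hook from the lowest on. -/
def SRHGTabloid.word (T : SRHGTabloid G lam) : List P :=
  T.hooks.flatten.pmap (fun c h => T.fill ⟨c, h⟩) fun c hc =>
    (T.isRimHookTabloid.flatten.2 c).1 hc

theorem SRHGTabloid.word_nodup (T : SRHGTabloid G lam) : T.word.Nodup :=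
  T.isRimHookTabloid.flatten.1.pmap fun c hc d hd h => by
    simpa using T.fill.injective h

theorem SRHGTabloid.mem_word (T : SRHGTabloid G lam) (v : P) : v ∈ T.word := by
  refine List.mem_pmap.2 ⟨(T.fill.symm v).1, ?_, by simp⟩
  exact (T.isRimHookTabloid.flatten.2 _).2 (T.fill.symm v).2

theorem SRHGTabloid.incBlocks_word (T : SRHGTabloid G lam) :
    IncBlocks (T.hooks.map List.length) T.word :=
  (incBlocks_pmap_flatten (fun c h => T.fill ⟨c, h⟩) _ _).2 T.increasing

theorem filterMap_reverse_range {α : Type*} (f : ℕ → Option α) (g : ℕ → α) (m n : ℕ)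
    (hmn : m ≤ n) (h1 : ∀ i < m, f i = none) (h2 : ∀ i, m ≤ i → i < n → f i = some (g i)) :
    (List.range n).reverse.filterMap f =
      (List.range (n - m)).map fun i => g (n - 1 - i) := by
  induction n, hmn using Nat.le_induction with
  | base =>
    rw [Nat.sub_self, List.range_zero, List.map_nil, List.filterMap_eq_nil_iff]
    intro i hi
    exact h1 i (by simpa using hi)
  | succ n hmn ih =>
    rw [List.range_succ, List.reverse_append, List.reverse_singleton, List.singleton_append,
      List.filterMap_cons_some (h2 n hmn (by omega)), ih fun i h h' => h2 i h (by omega),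
      show n + 1 - m = (n - m) + 1 by omega, List.range_succ_eq_map, List.map_cons, List.map_map]
    refine congrArg₂ _ (by simp) (List.map_congr_left fun i _ => ?_)
    simp only [Function.comp]
    congr 1
    omega

theorem SRHGTabloid.tailSeq_eq_take (T : SRHGTabloid G lam) :
    T.tailSeq = T.word.take (lam.colLen 0 - lam.colLen 1) := by
  have hle := lam.colLen_anti 0 1 (by omega)
  rcases Nat.eq_zero_or_pos (lam.colLen 0 - lam.colLen 1) with h0 | hpos
  · rw [h0, List.take_zero, SRHGTabloid.tailSeq, List.filterMap_eq_nil_iff]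
    intro i hi
    rw [dif_neg]
    rw [rowLen_eq_one_iff]
    omega
  have hne : (0, 0) ∈ lam := YoungDiagram.mem_iff_lt_colLen.2 (by omega)
  rw [SRHGTabloid.tailSeq, filterMap_reverse_range _
    (fun i => if h : (i, 0) ∈ lam then T.fill ⟨(i, 0), h⟩ else T.fill ⟨(0, 0), hne⟩) _ _ hle]
  · apply List.ext_getElem?
    intro i
    rcases Nat.lt_or_ge i (lam.colLen 0 - lam.colLen 1) with hi | hi
    · have hmem : (lam.colLen 0 - 1 - i, 0) ∈ lam :=
        YoungDiagram.mem_iff_lt_colLen.2 (by omega)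
      rw [List.getElem?_map, List.getElem?_range hi, List.getElem?_take_of_lt hi,
        SRHGTabloid.word, List.getElem?_pmap]
      simp only [Option.map_some, dif_pos hmem]
      simp only [T.flatten_getElem? hi, Option.pmap_some]
    · rw [List.getElem?_eq_none (by simpa using hi), List.getElem?_eq_none]
      rw [List.length_take]
      omega
  · intro i hi
    rw [dif_neg]
    rw [rowLen_eq_one_iff]
    omega
  · intro i h1 h2
    have hmem : (i, 0) ∈ lam := YoungDiagram.mem_iff_lt_colLen.2 h2
    rw [dif_pos (rowLen_eq_one_iff.2 ⟨h1, h2⟩), dif_pos hmem]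

theorem SRHGTabloid.ext_of_word {T S : SRHGTabloid G lam} (h1 : T.toSRHTabloid = S.toSRHTabloid)
    (h2 : T.word = S.word) : T = S := by
  refine SRHGTabloid.ext (congrArg SRHTabloid.hooks h1) (Equiv.ext ?_)
  rintro ⟨c, hc⟩
  obtain ⟨i, hi, rfl⟩ := List.getElem_of_mem ((T.isRimHookTabloid.flatten.2 c).2 hc)
  have h3 : T.word[i]? = S.word[i]? := by rw [h2]
  simp only [SRHGTabloid.word, List.getElem?_pmap, ← h1] at h3
  simpa [List.getElem?_eq_getElem hi] using h3

/-- The cells, listed hook by hook, are matched with the letters in order. Stability is automatic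
for `incGraph`, since the vertices of an increasing hook are pairwise comparable. -/
theorem SRHGTabloid.exists_word (T : SRHTabloid lam) {w : List P} (hw : w.Nodup)
    (hw' : ∀ v, v ∈ w) (hinc : IncBlocks (T.hooks.map List.length) w) :
    ∃ S : SRHGTabloid (incGraph P) lam, S.toSRHTabloid = T ∧ S.word = w := by
  classical
  have hT := T.isRimHookTabloid.flatten
  have hlen : T.hooks.flatten.length = w.length := by
    rw [hinc.length_eq, List.length_flatten]
  let L : List {c : ℕ × ℕ // c ∈ lam} := T.hooks.flatten.attachWith (· ∈ lam) fun c hc =>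
    (hT.2 c).1 hc
  have hL : L.Nodup := by
    refine List.Nodup.of_map Subtype.val ?_
    rw [List.attachWith_map_subtype_val]
    exact hT.1
  have hL' : ∀ c, c ∈ L := fun c => by
    rw [List.mem_attachWith]
    exact (hT.2 _).2 c.2
  have hLlen : L.length = w.length := by rw [List.length_attachWith, hlen]
  let e : {c : ℕ × ℕ // c ∈ lam} ≃ P := (hL.getEquivOfForallMemList _ hL').symm.trans
    ((finCongr hLlen).trans (hw.getEquivOfForallMemList _ hw'))
  have he : T.hooks.flatten.pmap (fun c h => e ⟨c, h⟩) (fun c hc => (hT.2 c).1 hc) = w := by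
    apply List.ext_getElem
    · simpa using hlen
    · intro i h1 h2
      rw [List.getElem_pmap]
      have h3 : (⟨T.hooks.flatten[i]'(by omega), (hT.2 _).1 (List.getElem_mem _)⟩ :
          {c : ℕ × ℕ // c ∈ lam}) = hL.getEquivOfForallMemList _ hL' ⟨i, by omega⟩ := by
        apply Subtype.ext
        simp [L]
      simp only [h3, e, Equiv.trans_apply, Equiv.symm_apply_apply]
      simp
  have hincr : ∀ r ∈ T.hooks, r.Pairwise fun c d =>
      ∀ (hc : c ∈ lam) (hd : d ∈ lam), e ⟨c, hc⟩ < e ⟨d, hd⟩ := by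
    rw [← incBlocks_pmap_flatten (fun c h => e ⟨c, h⟩) T.hooks fun c hc => (hT.2 c).1 hc, he]
    exact hinc
  refine ⟨⟨T, e, ?_, hincr⟩, rfl, he⟩
  rintro r hr _ ⟨c, hc, rfl⟩ _ ⟨d, hd, rfl⟩ hne
  have hsymm : Std.Symm fun c d : ℕ × ℕ => ∀ (hc : c ∈ lam) (hd : d ∈ lam),
      e ⟨c, hc⟩ ≤ e ⟨d, hd⟩ ∨ e ⟨d, hd⟩ ≤ e ⟨c, hc⟩ := ⟨fun a b h hc hd => (h hd hc).symm⟩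
  have hpair : r.Pairwise fun c d : ℕ × ℕ => ∀ (hc : c ∈ lam) (hd : d ∈ lam),
      e ⟨c, hc⟩ ≤ e ⟨d, hd⟩ ∨ e ⟨d, hd⟩ ≤ e ⟨c, hc⟩ :=
    (hincr r hr).imp fun h hc hd => Or.inl (h hc hd).le
  have hcomp := hpair.forall_of_forall (fun c _ hc hd => Or.inl le_rfl) hc hd c.2 d.2
  rintro ⟨h1, h2⟩
  exact hcomp.elim h1 h2

end words

open Classical in
/-- The words that contain each element of `S` once and no other element. -/
def words {P : Type*} (S : Finset P) : Finset (List P) :=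
  S.toList.permutations.toFinset

theorem mem_words {P : Type*} {S : Finset P} {w : List P} :
    w ∈ words S ↔ w.Nodup ∧ ∀ v, v ∈ w ↔ v ∈ S := by
  classical
  rw [words, List.mem_toFinset, List.mem_permutations]
  constructor
  · intro h
    exact ⟨h.nodup_iff.2 S.nodup_toList, fun v => by rw [h.mem_iff, Finset.mem_toList]⟩
  · rintro ⟨h1, h2⟩
    exact (List.perm_ext_iff_of_nodup h1 S.nodup_toList).2 fun v => by
      rw [h2, Finset.mem_toList]

open Classical in
-- A tabloid is a pair of a word and an unfilled tabloid. Words whose tail fails to be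
-- non-increasing may be included in the sum because their signed count vanishes.
theorem sum_nonIncreasingTailTabloids {P : Type*} [Fintype P] [PartialOrder P]
    (lam : YoungDiagram) :
    ∑ T ∈ nonIncreasingTailTabloids (incGraph P) lam, (T.sgn : ℚ) =
      ∑ w ∈ words (Finset.univ : Finset P), signedCount lam w := by
  have hlists : ∀ w : List P, w ∈ words (Finset.univ : Finset P) ↔ w.Nodup ∧ ∀ v, v ∈ w := by
    simp [mem_words]
  rw [← Finset.sum_filter_of_ne (p := fun w => NonIncreasing
    (w.take (lam.colLen 0 - lam.colLen 1))) fun w hw h =>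
      nonIncreasing_of_signedCount_ne_zero ((hlists w).1 hw).1 h]
  simp only [signedCount]
  simp only [← Finset.sum_filter]
  rw [Finset.sum_sigma']
  refine Finset.sum_bij (fun T _ => ⟨T.word, T.toSRHTabloid⟩) ?_ ?_ ?_ ?_
  · intro T hT
    simp only [Finset.mem_sigma, Finset.mem_filter, Finset.mem_univ, true_and]
    refine ⟨⟨(hlists _).2 ⟨T.word_nodup, T.mem_word⟩, ?_⟩, T.incBlocks_word⟩
    rw [← T.tailSeq_eq_take]
    exact (Finset.mem_filter.1 hT).2
  · intro T _ S _ h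
    rw [Sigma.mk.injEq] at h
    exact SRHGTabloid.ext_of_word (eq_of_heq h.2) h.1
  · rintro ⟨w, T⟩ h
    simp only [Finset.mem_sigma, Finset.mem_filter, Finset.mem_univ, true_and] at h
    obtain ⟨⟨h1, h2⟩, h3⟩ := h
    obtain ⟨S, rfl, rfl⟩ := SRHGTabloid.exists_word T ((hlists w).1 h1).1 ((hlists w).1 h1).2 h3
    refine ⟨S, Finset.mem_filter.2 ⟨Finset.mem_univ _, ?_⟩, rfl⟩
    rwa [S.tailSeq_eq_take]
  · intro T _
    rfl

/-! ### Generating polynomials of chains -/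

section chains
variable {P : Type*} [PartialOrder P]

theorem eq_of_pairwise_lt {c d : List P} (hc : c.Pairwise (· < ·)) (hd : d.Pairwise (· < ·))
    (h : ∀ v, v ∈ c ↔ v ∈ d) : c = d := by
  have hn : ∀ {l : List P}, l.Pairwise (· < ·) → l.Nodup := fun hl => hl.imp fun h => h.ne
  refine ((List.perm_ext_iff_of_nodup (hn hc) (hn hd)).2 h).eq_of_pairwise ?_ hc hd
  intro a b _ _ h1 h2
  exact absurd (h1.trans h2) (lt_irrefl _)

theorem exists_pairwise_lt_of_isChain (C : Finset P) (hC : IsChain (· ≤ ·) (C : Set P)) :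
    ∃ c : List P, c.Pairwise (· < ·) ∧ ∀ v, v ∈ c ↔ v ∈ C := by
  classical
  induction hn : C.card generalizing C with
  | zero =>
    rw [Finset.card_eq_zero] at hn
    exact ⟨[], List.Pairwise.nil, by simp [hn]⟩
  | succ n ih =>
    have hne : C.Nonempty := Finset.card_pos.1 (by omega)
    obtain ⟨m, hm⟩ := C.exists_minimal hne
    obtain ⟨c, hc1, hc2⟩ := ih (C.erase m) (hC.mono (by simp))
      (by rw [Finset.card_erase_of_mem hm.1]; omega)
    refine ⟨m :: c, List.pairwise_cons.2 ⟨fun v hv => ?_, hc1⟩, fun v => ?_⟩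
    · obtain ⟨h1, h2⟩ := Finset.mem_erase.1 ((hc2 v).1 hv)
      rcases hC hm.1 h2 h1.symm with h | h
      · exact lt_of_le_of_ne h h1.symm
      · exact lt_of_le_of_ne (hm.2 h2 h) h1.symm
    · rw [List.mem_cons, hc2, Finset.mem_erase]
      by_cases hv : v = m
      · simp [hv, hm.1]
      · simp [hv]

theorem isChain_of_pairwise_lt {c : List P} (hc : c.Pairwise (· < ·)) {C : Set P}
    (h : ∀ v ∈ C, v ∈ c) : IsChain (· ≤ ·) C := by
  have hsymm : Std.Symm fun a b : P => a ≤ b ∨ b ≤ a := ⟨fun a b h => h.symm⟩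
  have hpair : c.Pairwise fun a b : P => a ≤ b ∨ b ≤ a := hc.imp fun h => Or.inl h.le
  intro a ha b hb _
  exact hpair.forall_of_forall (R := fun a b : P => a ≤ b ∨ b ≤ a) (fun a _ => Or.inl le_rfl)
    (h a ha) (h b hb)

open Classical in
/-- The exponent vector of the squarefree monomial of a finite set. -/
def setExp {P : Type*} (S : Finset P) : P →₀ ℕ :=
  Finsupp.indicator S fun _ _ => 1

open Classical in
theorem setExp_apply {P : Type*} (S : Finset P) (v : P) : setExp S v = if v ∈ S then 1 else 0 := by
  simp [setExp, Finsupp.indicator_apply]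

theorem setExp_le {P : Type*} {S T : Finset P} : setExp S ≤ setExp T ↔ S ⊆ T := by
  classical
  constructor
  · intro h v hv
    have := h v
    by_contra hv'
    simp [setExp_apply, hv, hv'] at this
  · intro h v
    have := @h v
    simp only [setExp_apply]
    split_ifs <;> simp_all

open Classical in
theorem setExp_sub {P : Type*} (S T : Finset P) : setExp S - setExp T = setExp (S \ T) := by
  ext v
  simp only [Finsupp.tsub_apply, setExp_apply, Finset.mem_sdiff]
  split_ifs <;> simp_all

open Classical in
/-- The chains with `m` elements. -/
def chainsOfCard (P : Type*) [PartialOrder P] [Fintype P] (m : ℕ) : Finset (Finset P) :=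
  Finset.univ.filter fun C => IsChain (· ≤ ·) (C : Set P) ∧ C.card = m

theorem mem_chainsOfCard [Fintype P] {m : ℕ} {C : Finset P} :
    C ∈ chainsOfCard P m ↔ IsChain (· ≤ ·) (C : Set P) ∧ C.card = m := by
  simp [chainsOfCard]

/-- The sum of the squarefree monomials of the chains with `m` elements. -/
def chainPoly (P : Type*) [PartialOrder P] [Fintype P] (m : ℕ) : MvPolynomial P ℚ :=
  ∑ C ∈ chainsOfCard P m, MvPolynomial.monomial (setExp C) 1

theorem chainPoly_zero [Fintype P] : chainPoly P 0 = 1 := by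
  have : chainsOfCard P 0 = {∅} := by
    ext C
    rw [mem_chainsOfCard, Finset.card_eq_zero, Finset.mem_singleton]
    constructor
    · exact fun h => h.2
    · rintro rfl
      simp
  rw [chainPoly, this, Finset.sum_singleton]
  have h0 : setExp (∅ : Finset P) = 0 := by
    classical
    ext v
    simp [setExp_apply]
  rw [h0]
  rfl

open Classical in
-- A chain has exactly one increasing arrangement, so fixing the set of letters of the first block
-- fixes the block.
theorem card_words_incBlocks_fiber [Fintype P] (S C : Finset P) {m : ℕ} (ms : List ℕ)
    (hC : C ∈ chainsOfCard P m) :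
    (((words S).filter (IncBlocks (m :: ms))).filter fun w => (w.take m).toFinset = C).card =
      if C ⊆ S then ((words (S \ C)).filter (IncBlocks ms)).card else 0 := by
  obtain ⟨h1, h2⟩ := mem_chainsOfCard.1 hC
  obtain ⟨c, hc1, hc2⟩ := exists_pairwise_lt_of_isChain C h1
  have hcn : c.Nodup := hc1.imp fun h => h.ne
  have hclen : c.length = m := by
    rw [← h2, ← List.toFinset_card_of_nodup hcn]
    congr 1
    ext v
    rw [List.mem_toFinset, hc2]
  split_ifs with hCS
  · refine Finset.card_nbij' (fun w => w.drop m) (fun w => c ++ w) ?_ ?_ ?_ ?_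
    · intro w hw
      simp only [Finset.coe_filter, Finset.mem_filter, Set.mem_ofPred_eq, mem_words] at hw ⊢
      obtain ⟨⟨⟨g1, g2⟩, g3⟩, g4⟩ := hw
      refine ⟨⟨(List.drop_sublist _ _).nodup g1, fun v => ?_⟩, g3.2⟩
      have e := List.take_append_drop m w
      rw [← e] at g1
      rw [Finset.mem_sdiff, ← g2, ← g4, List.mem_toFinset]
      constructor
      · intro hv
        exact ⟨List.mem_of_mem_drop hv, fun hv' => (List.disjoint_of_nodup_append g1) hv' hv⟩
      · rintro ⟨hv, hv'⟩
        rw [← e, List.mem_append] at hv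
        exact hv.resolve_left hv'
    · intro w hw
      simp only [Finset.coe_filter, Finset.mem_filter, Set.mem_ofPred_eq, mem_words] at hw ⊢
      obtain ⟨⟨g1, g2⟩, g3⟩ := hw
      refine ⟨⟨⟨?_, fun v => ?_⟩, ⟨⟨?_, ?_⟩, ?_⟩⟩, ?_⟩
      · refine List.Nodup.append hcn g1 fun v hv hv' => ?_
        exact (Finset.mem_sdiff.1 ((g2 v).1 hv')).2 ((hc2 v).1 hv)
      · rw [List.mem_append, hc2, g2, Finset.mem_sdiff]
        have := @hCS v
        tauto
      · rw [List.length_append]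
        omega
      · rwa [List.take_left' hclen]
      · rwa [List.drop_left' hclen]
      · rw [List.take_left' hclen]
        ext v
        rw [List.mem_toFinset, hc2]
    · intro w hw
      simp only [Finset.coe_filter, Finset.mem_filter, Set.mem_ofPred_eq, mem_words] at hw
      obtain ⟨⟨⟨g1, g2⟩, g3⟩, g4⟩ := hw
      have : c = w.take m := eq_of_pairwise_lt hc1 g3.1.2 fun v => by
        rw [hc2, ← g4, List.mem_toFinset]
      simp only [this, List.take_append_drop]
    · intro w hw
      simp only [List.drop_left' hclen]
  · rw [Finset.card_eq_zero, Finset.filter_eq_empty_iff]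
    intro w hw hwC
    refine hCS fun v hv => ?_
    rw [← hwC, List.mem_toFinset] at hv
    exact ((mem_words.1 (Finset.mem_filter.1 hw).1).2 v).1 (List.mem_of_mem_take hv)

open Classical in
-- Squarefreeness forces the chains chosen from the factors to be disjoint with union `S`. Such
-- ordered partitions into chains are the words, cut into blocks.
theorem card_words_incBlocks [Fintype P] (S : Finset P) (ms : List ℕ) :
    (((words S).filter (IncBlocks ms)).card : ℚ) =
      MvPolynomial.coeff (setExp S) (ms.map (chainPoly P)).prod := by
  induction ms generalizing S with
  | nil =>
    rw [List.map_nil, List.prod_nil, MvPolynomial.coeff_one]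
    by_cases hS : S = ∅
    · subst hS
      have h0 : (0 : P →₀ ℕ) = setExp (∅ : Finset P) := by
        ext v
        simp [setExp_apply]
      have : (words (∅ : Finset P)).filter (IncBlocks []) = {[]} := by
        ext w
        rw [Finset.mem_filter, Finset.mem_singleton, mem_words]
        constructor
        · exact fun h => h.2
        · rintro rfl
          exact ⟨by simp, rfl⟩
      rw [this, if_pos h0]
      simp
    · rw [if_neg]
      · rw [Nat.cast_eq_zero, Finset.card_eq_zero, Finset.filter_eq_empty_iff]
        intro w hw hw'
        obtain ⟨v, hv⟩ := Finset.nonempty_iff_ne_empty.2 hS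
        have := ((mem_words.1 hw).2 v).2 hv
        rw [show w = [] from hw'] at this
        simp at this
      · intro h
        obtain ⟨v, hv⟩ := Finset.nonempty_iff_ne_empty.2 hS
        have := DFunLike.congr_fun h v
        simp [setExp_apply, hv] at this
  | cons m ms ih =>
    have hmaps : ∀ w ∈ (words S).filter (IncBlocks (m :: ms)),
        (w.take m).toFinset ∈ chainsOfCard P m := by
      intro w hw
      obtain ⟨h1, ⟨h2, h3⟩, h4⟩ := Finset.mem_filter.1 hw
      refine mem_chainsOfCard.2 ⟨isChain_of_pairwise_lt h3 (by simp), ?_⟩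
      rw [List.toFinset_card_of_nodup (h3.imp fun h => h.ne), List.length_take]
      omega
    rw [Finset.card_eq_sum_card_fiberwise hmaps, List.map_cons, List.prod_cons, chainPoly,
      Finset.sum_mul, MvPolynomial.coeff_sum, Nat.cast_sum]
    refine Finset.sum_congr rfl fun C hC => ?_
    rw [card_words_incBlocks_fiber S C ms hC, MvPolynomial.coeff_monomial_mul', setExp_sub, ← ih]
    simp only [setExp_le, one_mul]
    split_ifs <;> simp

theorem sum_words_signedCount [Fintype P] (lam : YoungDiagram) {n : ℕ}
    (hn : lam.colLen 0 ≤ n) :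
    ∑ w ∈ words (Finset.univ : Finset P), signedCount lam w =
      MvPolynomial.coeff (setExp Finset.univ) (jacobiTrudi (chainPoly P) lam.rowLen n).det := by
  classical
  rw [det_jacobiTrudi _ chainPoly_zero n lam hn, MvPolynomial.coeff_sum]
  simp only [signedCount]
  rw [Finset.sum_comm]
  refine Finset.sum_congr rfl fun T _ => ?_
  have h1 : ((T.sgn : ℤ) : MvPolynomial P ℚ) = MvPolynomial.C (T.sgn : ℚ) := by simp
  have h2 : (T.hooks.map fun r => chainPoly P r.length) =
      (T.hooks.map List.length).map (chainPoly P) := by simp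
  rw [h1, MvPolynomial.coeff_C_mul, h2, ← card_words_incBlocks, ← Finset.sum_filter,
    Finset.sum_const, nsmul_eq_mul, mul_comm]

/-! ### The chromatic polynomial in finitely many variables -/

open Classical in
/-- The number of proper colourings of the incomparability graph with `n` colours and prescribed
sizes of the colour classes, as a coefficient. -/
theorem card_colorings_eq_coeff [Fintype P] (n : ℕ) (α : Fin n → ℕ) :
    ((Finset.univ.filter fun C : P → Fin n =>
      (∀ v w, (incGraph P).Adj v w → C v ≠ C w) ∧
        ∀ i, (Finset.univ.filter fun v => C v = i).card = α i).card : ℚ) =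
      MvPolynomial.coeff (setExp Finset.univ) (∏ i, chainPoly P (α i)) := by
  simp only [chainPoly]
  rw [Finset.prod_univ_sum, MvPolynomial.coeff_sum]
  have hmon : ∀ f : Fin n → Finset P, ∏ i, MvPolynomial.monomial (setExp (f i)) (1 : ℚ) =
      MvPolynomial.monomial (∑ i, setExp (f i)) 1 := by
    intro f
    rw [MvPolynomial.monomial_sum_one]
  simp only [hmon, MvPolynomial.coeff_monomial]
  rw [Finset.sum_ite, Finset.sum_const_zero, add_zero, Finset.sum_const, nsmul_one, Nat.cast_inj]
  -- All exponents being one, each vertex lies in exactly one of the sets, and the index of that set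
  -- is its colour.
  have hex : ∀ f : Fin n → Finset P, ∑ i, setExp (f i) = setExp Finset.univ →
      ∀ v, ∃! i, v ∈ f i := by
    intro f hf v
    have h := DFunLike.congr_fun hf v
    simp only [Finsupp.finsetSum_apply, setExp_apply, Finset.mem_univ, if_true,
      Finset.sum_boole, Nat.cast_id] at h
    obtain ⟨i, hi⟩ := Finset.card_eq_one.1 h
    have hi' : ∀ j, v ∈ f j ↔ j = i := fun j => by
      rw [← Finset.mem_singleton, ← hi]
      simp
    exact ⟨i, (hi' i).2 rfl, fun j hj => (hi' j).1 hj⟩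
  refine Finset.card_bij (fun C _ i => Finset.univ.filter fun v => C v = i) ?_ ?_ ?_
  · intro C hC
    obtain ⟨-, hC1, hC2⟩ := Finset.mem_filter.1 hC
    refine Finset.mem_filter.2 ⟨Fintype.mem_piFinset.2 fun i => mem_chainsOfCard.2
      ⟨fun v hv w hw _ => ?_, hC2 i⟩, ?_⟩
    · simp only [Finset.coe_filter, Finset.mem_univ, true_and, Set.mem_ofPred_eq] at hv hw
      by_contra h
      rw [not_or] at h
      exact hC1 v w h (hv.trans hw.symm)
    · ext v
      simp [setExp_apply]
  · intro C _ D _ h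
    funext v
    have := congrFun h (C v)
    have hv : v ∈ Finset.univ.filter fun w => D w = C v := by
      rw [← this]
      simp
    exact (Finset.mem_filter.1 hv).2.symm
  · intro f hf
    obtain ⟨hf1, hf2⟩ := Finset.mem_filter.1 hf
    have hf3 := hex f hf2
    choose C hC1 hC2 using hf3
    have hfC : ∀ i, (Finset.univ.filter fun v => C v = i) = f i := by
      intro i
      ext v
      simp only [Finset.mem_filter, Finset.mem_univ, true_and]
      constructor
      · rintro rfl
        exact hC1 v
      · intro hv
        exact (hC2 v i hv).symm
    refine ⟨C, Finset.mem_filter.2 ⟨Finset.mem_univ _, ?_, ?_⟩, funext hfC⟩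
    · intro v w hvw he
      have hch := (mem_chainsOfCard.1 (Fintype.mem_piFinset.1 hf1 (C v))).1
      have hne : v ≠ w := fun e => (incGraph P).loopless.irrefl v (e ▸ hvw)
      rcases hch (hC1 v) (he ▸ hC1 w) hne with h | h
      · exact hvw.1 h
      · exact hvw.2 h
    · intro i
      rw [hfC]
      exact (mem_chainsOfCard.1 (Fintype.mem_piFinset.1 hf1 i)).2

end chains

/-! ### Alternants -/

section alternant
variable {R : Type*} [CommRing R] (x : ℕ → R)

/-- The determinant with entries `x i ^ l j`. -/
def alternant (n : ℕ) (l : Fin n → ℕ) : R :=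
  (Matrix.of fun i j : Fin n => x i ^ l j).det

theorem sub_mul_sum_Ico (y z : R) {a b : ℕ} (hab : a ≤ b) :
    (y - z) * ∑ m ∈ Finset.Ico a b, z ^ (b - 1 - m) * y ^ m = y ^ b - z ^ (b - a) * y ^ a := by
  rw [mul_comm (z ^ _), ← mul_geom_sum₂_Ico y z hab]
  simp only [mul_comm]

/-- Subtracting from each column a suitable power of `x n` times the next one clears the last row
except for its last entry. The remaining entries are divisible by `x i - x n`, the quotients are
geometric sums, and multilinearity in the columns expands the determinant. -/
theorem alternant_succ {n : ℕ} (l : Fin (n + 1) → ℕ) (hl : ∀ j : Fin n, l j.succ ≤ l j.castSucc) :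
    alternant x (n + 1) l = x n ^ l (Fin.last n) * (∏ i : Fin n, (x i - x n)) *
      ∑ m ∈ Fintype.piFinset fun j : Fin n => Finset.Ico (l j.succ) (l j.castSucc),
        (∏ j : Fin n, x n ^ (l j.castSucc - 1 - m j)) * alternant x n m := by
  set M : Matrix (Fin (n + 1)) (Fin (n + 1)) R := Matrix.of fun i j => x i ^ l j with hM
  let M' : Matrix (Fin (n + 1)) (Fin (n + 1)) R := Matrix.of fun i j =>
    Fin.lastCases (x i ^ l (Fin.last n))
      (fun j => x i ^ l j.castSucc - x n ^ (l j.castSucc - l j.succ) * x i ^ l j.succ) j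
  have h1 : M.det = M'.det := by
    -- The column lemma adds multiples of the preceding column, whereas here the following one is
    -- needed, so the indices are reversed.
    rw [← Matrix.det_submatrix_equiv_self Fin.revPerm M,
      ← Matrix.det_submatrix_equiv_self Fin.revPerm M']
    refine Matrix.det_eq_of_forall_col_eq_smul_add_pred
      (fun j => x n ^ (l j.rev.castSucc - l j.rev.succ)) ?_ ?_
    · intro i
      simp [M, M']
    · intro i j
      simp [M, M', Fin.rev_succ, Fin.rev_castSucc]
  let N : Matrix (Fin n) (Fin n) R := Matrix.of fun i j =>
    ∑ m ∈ Finset.Ico (l j.succ) (l j.castSucc), x n ^ (l j.castSucc - 1 - m) * x i ^ m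
  have h2 : M'.det = x n ^ l (Fin.last n) *
      (Matrix.of fun i j : Fin n => (x i - x n) * N i j).det := by
    rw [Matrix.det_succ_row _ (Fin.last n), Finset.sum_eq_single (Fin.last n)]
    · have : M'.submatrix (Fin.last n).succAbove (Fin.last n).succAbove =
          Matrix.of fun i j : Fin n => (x i - x n) * N i j := by
        ext i j
        simp only [M', N, Matrix.submatrix_apply, Matrix.of_apply, Fin.succAbove_last,
          Fin.lastCases_castSucc, Fin.val_castSucc]
        rw [sub_mul_sum_Ico _ _ (hl j)]
      rw [this]
      simp [M', ← two_mul]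
    · intro j _ hj
      obtain ⟨j, rfl⟩ := Fin.exists_castSucc_eq.2 hj
      simp only [M', Matrix.of_apply, Fin.lastCases_castSucc, Fin.val_last]
      rw [← pow_add, Nat.sub_add_cancel (hl j)]
      simp
    · simp
  have h3 : N.det = ∑ m ∈ Fintype.piFinset fun j : Fin n => Finset.Ico (l j.succ) (l j.castSucc),
        (∏ j : Fin n, x n ^ (l j.castSucc - 1 - m j)) * alternant x n m := by
    have hN : N.transpose = fun j => ∑ m ∈ Finset.Ico (l j.succ) (l j.castSucc),
        x n ^ (l j.castSucc - 1 - m) • fun i : Fin n => x i ^ m := by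
      funext j i
      simp [N, Finset.sum_apply]
    rw [← Matrix.det_transpose, hN]
    have := (Matrix.detRowAlternating (n := Fin n) (R := R)).toMultilinearMap.map_sum_finset
      (fun (j : Fin n) (m : ℕ) => x n ^ (l j.castSucc - 1 - m) • fun i : Fin n => x i ^ m)
      (fun j : Fin n => Finset.Ico (l j.succ) (l j.castSucc))
    refine Eq.trans this (Finset.sum_congr rfl fun m _ => ?_)
    rw [MultilinearMap.map_smul_univ, smul_eq_mul, alternant, ← Matrix.det_transpose]
    rfl
  rw [alternant, ← hM, h1, h2, Matrix.det_mul_column, h3, mul_assoc]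

/-- The alternant of the exponents `p j + (n - 1 - j)`. -/
def shiftedAlternant (n : ℕ) (p : Fin n → ℕ) : R :=
  alternant x n fun j => p j + (n - 1 - j)

/-- The shift for `n + 1` variables exceeds that for `n` by one in each entry. This turns the
half-open intervals of exponents into the closed intervals of interlacing. -/
theorem shiftedAlternant_succ {n : ℕ} (p : Fin (n + 1) → ℕ)
    (hp : ∀ j : Fin n, p j.succ ≤ p j.castSucc) :
    shiftedAlternant x (n + 1) p = (∏ i : Fin n, (x i - x n)) *
      ∑ m ∈ Fintype.piFinset fun j : Fin n => Finset.Icc (p j.succ) (p j.castSucc),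
        x n ^ (p (Fin.last n) + ∑ j, (p j.castSucc - m j)) * shiftedAlternant x n m := by
  rw [shiftedAlternant, alternant_succ]
  · rw [mul_comm (x n ^ _) (∏ i : Fin n, (x i - x n)), mul_assoc]
    congr 1
    rw [Finset.mul_sum]
    symm
    refine Finset.sum_nbij' (fun m j => m j + (n - 1 - j)) (fun m j => m j - (n - 1 - j))
      ?_ ?_ ?_ ?_ ?_
    · intro m hm
      rw [Fintype.mem_piFinset] at hm ⊢
      intro j
      have := Finset.mem_Icc.1 (hm j)
      have hj := j.2
      simp only [Finset.mem_Ico, Fin.val_succ, Fin.val_castSucc]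
      omega
    · intro m hm
      rw [Fintype.mem_piFinset] at hm ⊢
      intro j
      have := Finset.mem_Ico.1 (hm j)
      have hj := j.2
      simp only [Fin.val_succ, Fin.val_castSucc] at this
      simp only [Finset.mem_Icc]
      omega
    · intro m _
      funext j
      simp
    · intro m hm
      rw [Fintype.mem_piFinset] at hm
      funext j
      have := Finset.mem_Ico.1 (hm j)
      have hj := j.2
      simp only [Fin.val_succ, Fin.val_castSucc] at this
      simp only
      omega
    · intro m hm
      rw [Finset.prod_pow_eq_pow_sum, ← mul_assoc, ← pow_add]
      congr 2
      refine congrArg₂ _ (by simp) (Finset.sum_congr rfl fun j _ => ?_)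
      have hj := j.2
      simp only [Fin.val_castSucc]
      omega
  · intro j
    have := hp j
    simp only [Fin.val_succ, Fin.val_castSucc]
    omega

theorem shiftedAlternant_zero_succ (n : ℕ) :
    shiftedAlternant x (n + 1) 0 = (∏ i : Fin n, (x i - x n)) * shiftedAlternant x n 0 := by
  rw [shiftedAlternant_succ x 0 fun _ => le_rfl]
  have : (Fintype.piFinset fun j : Fin n => Finset.Icc ((0 : Fin (n + 1) → ℕ) j.succ)
      ((0 : Fin (n + 1) → ℕ) j.castSucc)) = {0} := by
    ext m
    simp [funext_iff]
  rw [this]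
  simp

end alternant

/-! ### Schur polynomials and the bialternant formula -/

/-- Semistandard tableaux with entries smaller than `n`. -/
abbrev BoundedSSYT (n : ℕ) (lam : YoungDiagram) : Type :=
  {Q : SemistandardYoungTableau lam // ∀ c ∈ lam.cells, Q c.1 c.2 < n}

instance (n : ℕ) (lam : YoungDiagram) : Finite (BoundedSSYT n lam) := by
  refine Finite.of_injective (β := {c : ℕ × ℕ // c ∈ lam.cells} → Fin n)
    (fun Q c => ⟨Q.1 c.1.1 c.1.2, Q.2 c.1 c.2⟩) fun Q Q' h => Subtype.ext ?_
  ext i j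
  by_cases hij : (i, j) ∈ lam.cells
  · exact congrArg Fin.val (congrFun h ⟨(i, j), hij⟩)
  · rw [Q.1.zeros hij, Q'.1.zeros hij]

instance (n : ℕ) (lam : YoungDiagram) : Fintype (BoundedSSYT n lam) := Fintype.ofFinite _

/-- The Schur polynomial in `x 0, …, x (n - 1)`. -/
def schurPoly {R : Type*} [CommRing R] (x : ℕ → R) (n : ℕ) (lam : YoungDiagram) : R :=
  ∑ Q : BoundedSSYT n lam, ∏ c ∈ lam.cells, x (Q.1 c.1 c.2)

/-- The restriction of a semistandard tableau to a smaller diagram. -/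
def restrictSSYT {mu lam : YoungDiagram} (h : mu ≤ lam) (Q : SemistandardYoungTableau lam) :
    SemistandardYoungTableau mu where
  entry i j := if (i, j) ∈ mu then Q i j else 0
  row_weak' := by
    intro i j1 j2 hj hc
    rw [if_pos hc, if_pos (mu.up_left_mem le_rfl hj.le hc)]
    exact Q.row_weak hj (h hc)
  col_strict' := by
    intro i1 i2 j hi hc
    rw [if_pos hc, if_pos (mu.up_left_mem hi.le le_rfl hc)]
    exact Q.col_strict hi (h hc)
  zeros' := fun hc => if_neg hc

theorem restrictSSYT_apply {mu lam : YoungDiagram} (h : mu ≤ lam)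
    (Q : SemistandardYoungTableau lam) (i j : ℕ) :
    restrictSSYT h Q i j = if (i, j) ∈ mu then Q i j else 0 :=
  rfl

/-- The extension of a semistandard tableau with entries smaller than `n` by entries `n` in a
horizontal strip. -/
def extendSSYT {mu lam : YoungDiagram} (n : ℕ) (h : mu ≤ lam) (Q : BoundedSSYT n mu)
    (hstrip : ∀ i j, (i + 1, j) ∈ lam → (i, j) ∈ mu) : SemistandardYoungTableau lam where
  entry i j := if (i, j) ∈ mu then Q.1 i j else if (i, j) ∈ lam then n else 0
  row_weak' := by
    intro i j1 j2 hj hc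
    have hc1 := lam.up_left_mem le_rfl hj.le hc
    by_cases h2 : (i, j2) ∈ mu
    · rw [if_pos h2, if_pos (mu.up_left_mem le_rfl hj.le h2)]
      exact Q.1.row_weak hj h2
    · rw [if_neg h2, if_pos hc, if_pos hc1]
      split_ifs with h1
      · exact (Q.2 _ h1).le
      · exact le_rfl
  col_strict' := by
    intro i1 i2 j hi hc
    have h1 : (i1, j) ∈ mu := hstrip _ _ (lam.up_left_mem (by omega) le_rfl hc)
    rw [if_pos h1]
    split_ifs with h2
    · exact Q.1.col_strict hi h2
    · exact Q.2 _ h1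
  zeros' := fun hc => by rw [if_neg fun hm => hc (h hm), if_neg hc]

theorem extendSSYT_apply {mu lam : YoungDiagram} (n : ℕ) (h : mu ≤ lam) (Q : BoundedSSYT n mu)
    (hstrip : ∀ i j, (i + 1, j) ∈ lam → (i, j) ∈ mu) (i j : ℕ) :
    extendSSYT n h Q hstrip i j = if (i, j) ∈ mu then Q.1 i j else if (i, j) ∈ lam then n else 0 :=
  rfl

/-- The diagram with row lengths `m 0, …, m (n - 1)`, if these are weakly decreasing. -/
def ofParts {n : ℕ} (m : Fin n → ℕ) : YoungDiagram where
  cells := (Finset.range n ×ˢ Finset.range (∑ k, m k)).filter fun c =>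
    ∀ k : Fin n, (k : ℕ) ≤ c.1 → c.2 < m k
  isLowerSet := by
    rintro ⟨i, j⟩ ⟨i', j'⟩ hle hc
    obtain ⟨h1, h2⟩ := Prod.mk_le_mk.1 hle
    simp only [Finset.coe_filter, Finset.mem_product, Finset.mem_range, Set.mem_ofPred_eq] at hc ⊢
    exact ⟨⟨by omega, by omega⟩, fun k hk => lt_of_le_of_lt h2 (hc.2 k (by omega))⟩

theorem mem_ofParts {n : ℕ} {m : Fin n → ℕ} (hm : Antitone m) {i j : ℕ} :
    (i, j) ∈ ofParts m ↔ ∃ h : i < n, j < m ⟨i, h⟩ := by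
  rw [← YoungDiagram.mem_cells]
  simp only [ofParts, Finset.mem_filter, Finset.mem_product, Finset.mem_range]
  constructor
  · rintro ⟨⟨h1, _⟩, h2⟩
    exact ⟨h1, h2 ⟨i, h1⟩ le_rfl⟩
  · rintro ⟨h1, h2⟩
    refine ⟨⟨h1, h2.trans_le ?_⟩, fun k hk => h2.trans_le (hm hk)⟩
    exact Finset.single_le_sum (f := m) (fun _ _ => Nat.zero_le _) (Finset.mem_univ _)

theorem rowLen_ofParts {n : ℕ} {m : Fin n → ℕ} (hm : Antitone m) (i : Fin n) :
    (ofParts m).rowLen i = m i :=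
  eq_rowLen_iff fun j => by
    rw [mem_ofParts hm]
    exact ⟨fun h => h.2, fun h => ⟨i.2, h⟩⟩

theorem colLen_ofParts_le {n : ℕ} {m : Fin n → ℕ} (hm : Antitone m) :
    (ofParts m).colLen 0 ≤ n := by
  by_contra hlt
  have := YoungDiagram.mem_iff_lt_colLen.2 (not_le.1 hlt)
  rw [mem_ofParts hm] at this
  exact absurd this.1 (lt_irrefl _)

theorem card_eq_sum_rowLen (lam : YoungDiagram) {n : ℕ} (hn : lam.colLen 0 ≤ n) :
    lam.cells.card = ∑ i : Fin n, lam.rowLen i := by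
  rw [Finset.card_eq_sum_card_fiberwise (f := Prod.fst) (t := Finset.range n),
    ← Fin.sum_univ_eq_sum_range fun i => (lam.cells.filter fun c => c.1 = i).card]
  · exact Finset.sum_congr rfl fun i _ => (lam.rowLen_eq_card).symm
  · rintro ⟨i, j⟩ hc
    have := YoungDiagram.mem_iff_lt_colLen.1 (lam.up_left_mem le_rfl (Nat.zero_le j) hc)
    simp only [Finset.coe_range, Set.mem_Iio]
    omega

theorem lt_card_filter_range {p : ℕ → Prop} [DecidablePred p] {k : ℕ}
    (hp : ∀ a b, a ≤ b → b < k → p b → p a) {c : ℕ} (hc : c < k) :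
    c < ((Finset.range k).filter p).card ↔ p c := by
  constructor
  · intro h
    by_contra hpc
    have hsub : (Finset.range k).filter p ⊆ Finset.range c := by
      intro b hb
      obtain ⟨h1, h2⟩ := Finset.mem_filter.1 hb
      rw [Finset.mem_range] at h1 ⊢
      by_contra hcb
      exact hpc (hp c b (by omega) h1 h2)
    have := Finset.card_le_card hsub
    rw [Finset.card_range] at this
    omega
  · intro h
    have hsub : Finset.range (c + 1) ⊆ (Finset.range k).filter p := by
      intro b hb
      rw [Finset.mem_range] at hb
      exact Finset.mem_filter.2 ⟨Finset.mem_range.2 (by omega), hp b c (by omega) hc h⟩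
    have := Finset.card_le_card hsub
    rw [Finset.card_range] at this
    omega

section branching
variable {n : ℕ} {lam : YoungDiagram}

variable (n lam) in
/-- The row lengths of the diagrams that are left when a horizontal strip is removed. -/
def interlacing : Finset (Fin n → ℕ) :=
  Fintype.piFinset fun j : Fin n => Finset.Icc (lam.rowLen (j + 1)) (lam.rowLen j)

theorem mem_interlacing {m : Fin n → ℕ} : m ∈ interlacing n lam ↔
    ∀ j : Fin n, lam.rowLen (j + 1) ≤ m j ∧ m j ≤ lam.rowLen j := by
  simp [interlacing, Fintype.mem_piFinset]

/-- The row lengths of the diagram of the cells with entries smaller than `n`. -/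
def innerParts (Q : BoundedSSYT (n + 1) lam) (j : Fin n) : ℕ :=
  ((Finset.range (lam.rowLen j)).filter fun c => Q.1 j c < n).card

theorem lt_innerParts_iff (Q : BoundedSSYT (n + 1) lam) (j : Fin n) {c : ℕ}
    (hc : ((j : ℕ), c) ∈ lam) : c < innerParts Q j ↔ Q.1 j c < n := by
  refine lt_card_filter_range (fun a b hab hb h => ?_) (YoungDiagram.mem_iff_lt_rowLen.1 hc)
  exact lt_of_le_of_lt (Q.1.row_weak_of_le hab (YoungDiagram.mem_iff_lt_rowLen.2 hb)) h

theorem innerParts_mem (Q : BoundedSSYT (n + 1) lam) :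
    innerParts Q ∈ interlacing n lam := by
  refine mem_interlacing.2 fun j => ⟨?_, ?_⟩
  · by_contra hlt
    have h1 : ((j : ℕ) + 1, innerParts Q j) ∈ lam :=
      YoungDiagram.mem_iff_lt_rowLen.2 (not_le.1 hlt)
    have h2 := Q.1.col_strict (Nat.lt_add_one j) h1
    have h3 := Q.2 _ h1
    have h4 := lt_innerParts_iff Q j (lam.up_left_mem (Nat.le_succ j) le_rfl h1)
    simp only at h3
    exact absurd (h4.2 (by omega)) (lt_irrefl _)
  · exact (Finset.card_filter_le _ _).trans (by simp)

theorem antitone_of_interlacing {m : Fin n → ℕ} (hm : m ∈ interlacing n lam) : Antitone m := by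
  intro i j hij
  have hi := mem_interlacing.1 hm i
  have hj := mem_interlacing.1 hm j
  rcases eq_or_lt_of_le hij with rfl | hlt
  · exact le_rfl
  · exact hj.2.trans ((lam.rowLen_anti (i + 1) j (by rw [Fin.lt_def] at hlt; omega)).trans hi.1)

theorem ofParts_le {m : Fin n → ℕ} (hm : m ∈ interlacing n lam) : ofParts m ≤ lam := by
  rintro ⟨i, j⟩ hc
  obtain ⟨h1, h2⟩ := (mem_ofParts (antitone_of_interlacing hm)).1 hc
  have := mem_interlacing.1 hm ⟨i, h1⟩
  exact YoungDiagram.mem_iff_lt_rowLen.2 (h2.trans_le this.2)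

theorem mem_ofParts_of_succ_mem {m : Fin n → ℕ} (hm : m ∈ interlacing n lam)
    (hn : lam.colLen 0 ≤ n + 1) (i j : ℕ) (h : (i + 1, j) ∈ lam) :
    (i, j) ∈ ofParts m := by
  have h1 := YoungDiagram.mem_iff_lt_colLen.1 (lam.up_left_mem le_rfl (Nat.zero_le j) h)
  have h2 : i < n := by omega
  have := mem_interlacing.1 hm ⟨i, h2⟩
  exact (mem_ofParts (antitone_of_interlacing hm)).2
    ⟨h2, (YoungDiagram.mem_iff_lt_rowLen.1 h).trans_le this.1⟩

/-- This is the branching rule: the cells with the largest entry `n` form a horizontal strip, and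
the other cells carry a tableau of an interlacing shape. -/
theorem schurPoly_succ {R : Type*} [CommRing R] (x : ℕ → R) (hn : lam.colLen 0 ≤ n + 1) :
    schurPoly x (n + 1) lam =
      ∑ m ∈ interlacing n lam,
        x n ^ (lam.rowLen n + ∑ j : Fin n, (lam.rowLen j - m j)) * schurPoly x n (ofParts m) := by
  classical
  rw [schurPoly, ← Finset.sum_fiberwise_of_maps_to (g := innerParts) fun Q _ => innerParts_mem Q]
  refine Finset.sum_congr rfl fun m hm => ?_
  have hanti := antitone_of_interlacing hm
  have hle := ofParts_le hm
  have hmem : ∀ Q : BoundedSSYT (n + 1) lam, innerParts Q = m → ∀ i j, (i, j) ∈ lam →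
      ((i, j) ∈ ofParts m ↔ Q.1 i j < n) := by
    rintro Q rfl i j hc
    rw [mem_ofParts hanti]
    constructor
    · rintro ⟨h1, h2⟩
      exact (lt_innerParts_iff Q ⟨i, h1⟩ hc).1 h2
    · intro h
      -- Entries increase strictly down a column, so a cell with entry below `n` lies in one of the
      -- first `n` rows, the only ones that `m` records.
      have hi : i ≤ Q.1 i j := by
        have : ∀ k ≤ i, k ≤ Q.1 k j := by
          intro k
          induction k with
          | zero => simp
          | succ k ih =>
            intro hk
            have := Q.1.col_strict (Nat.lt_add_one k) (lam.up_left_mem hk le_rfl hc)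
            have := ih (by omega)
            omega
        exact this i le_rfl
      exact ⟨by omega, (lt_innerParts_iff Q ⟨i, by omega⟩ hc).2 h⟩
  rw [schurPoly, Finset.mul_sum]
  refine Finset.sum_bij' (fun Q hQ => ⟨restrictSSYT hle Q.1, ?_⟩)
    (fun Q _ => ⟨extendSSYT n hle Q (mem_ofParts_of_succ_mem hm hn), ?_⟩) ?_ ?_ ?_ ?_ ?_
  · rintro ⟨i, j⟩ hc
    simp only
    rw [restrictSSYT_apply, if_pos (by exact hc)]
    exact (hmem Q (Finset.mem_filter.1 hQ).2 i j (hle hc)).1 hc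
  · rintro ⟨i, j⟩ hc
    simp only
    rw [extendSSYT_apply]
    split_ifs with h1 h2
    · exact (Q.2 _ h1).trans (Nat.lt_succ_self n)
    · exact Nat.lt_succ_self n
    · exact Nat.succ_pos n
  · intro Q _
    exact Finset.mem_univ _
  · intro Q _
    refine Finset.mem_filter.2 ⟨Finset.mem_univ _, funext fun j => ?_⟩
    rw [innerParts, ← Finset.card_range (m j)]
    congr 1
    ext c
    rw [Finset.mem_filter, Finset.mem_range, Finset.mem_range, extendSSYT_apply,
      ← YoungDiagram.mem_iff_lt_rowLen]
    have h1 : ((j : ℕ), c) ∈ ofParts m ↔ c < m j := by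
      rw [mem_ofParts hanti]
      exact ⟨fun h => h.2, fun h => ⟨j.2, h⟩⟩
    rw [← h1]
    constructor
    · rintro ⟨h2, h3⟩
      by_contra h4
      rw [if_neg h4, if_pos h2] at h3
      exact absurd h3 (lt_irrefl _)
    · intro h2
      rw [if_pos h2]
      exact ⟨hle h2, Q.2 _ h2⟩
  · intro Q hQ
    apply Subtype.ext
    ext i j
    simp only [extendSSYT_apply, restrictSSYT_apply]
    split_ifs with h1 h2
    · rfl
    · have h3 := (hmem Q (Finset.mem_filter.1 hQ).2 i j h2).not.1 h1
      have h4 := Q.2 _ h2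
      simp only at h4
      omega
    · exact (Q.1.zeros h2).symm
  · intro Q _
    apply Subtype.ext
    ext i j
    simp only [extendSSYT_apply, restrictSSYT_apply]
    split_ifs with h1
    · rfl
    · exact (Q.1.zeros h1).symm
  · intro Q hQ
    have hsub : (ofParts m).cells ⊆ lam.cells := hle
    rw [← Finset.prod_sdiff hsub]
    congr 1
    · rw [Finset.prod_congr rfl (g := fun _ => x n), Finset.prod_const,
        Finset.card_sdiff_of_subset hsub, card_eq_sum_rowLen lam hn,
        card_eq_sum_rowLen (ofParts m) (colLen_ofParts_le hanti), Fin.sum_univ_castSucc]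
      · congr 1
        simp only [rowLen_ofParts hanti, Fin.val_castSucc, Fin.val_last]
        rw [Finset.sum_tsub_distrib]
        · have : ∑ j : Fin n, m j ≤ ∑ j : Fin n, lam.rowLen j := Finset.sum_le_sum fun j _ =>
            (mem_interlacing.1 hm j).2
          omega
        · intro j _
          exact (mem_interlacing.1 hm j).2
      · rintro ⟨i, j⟩ hc
        rw [Finset.mem_sdiff, YoungDiagram.mem_cells, YoungDiagram.mem_cells] at hc
        have h3 := (hmem Q (Finset.mem_filter.1 hQ).2 i j hc.1).not.1 hc.2
        have h4 := Q.2 _ hc.1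
        simp only at h4 ⊢
        congr 1
        omega
    · refine Finset.prod_congr rfl fun c hc => ?_
      simp only
      rw [restrictSSYT_apply, if_pos (by exact hc)]

end branching

/-- The bialternant formula. -/
theorem shiftedAlternant_mul_schurPoly {R : Type*} [CommRing R] (x : ℕ → R) (n : ℕ)
    (lam : YoungDiagram) (hn : lam.colLen 0 ≤ n) :
    shiftedAlternant x n 0 * schurPoly x n lam = shiftedAlternant x n fun j => lam.rowLen j := by
  induction n generalizing lam with
  | zero =>
    obtain rfl := eq_bot_iff_colLen.2 (Nat.le_zero.1 hn)
    have : schurPoly x 0 ⊥ = 1 := by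
      rw [schurPoly, Fintype.sum_eq_single ⟨default, by simp⟩]
      · simp
      · intro Q hQ
        refine absurd (Subtype.ext ?_) hQ
        ext i j
        rw [Q.1.zeros (YoungDiagram.notMem_bot _),
          SemistandardYoungTableau.zeros _ (YoungDiagram.notMem_bot _)]
    rw [this, mul_one]
    simp [shiftedAlternant, alternant]
  | succ n ih =>
    -- Both sides branch over the same interlacing sequences with the same powers of `x n`; the
    -- factor ∏ (x i - x n) comes from a_δ on the left.
    rw [shiftedAlternant_succ x (fun j => lam.rowLen j) fun j =>
        lam.rowLen_anti (j.castSucc : ℕ) j.succ (by simp),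
      shiftedAlternant_zero_succ, schurPoly_succ x hn, mul_assoc, Finset.mul_sum]
    congr 1
    refine Finset.sum_congr rfl fun m hm => ?_
    have hanti := antitone_of_interlacing hm
    rw [mul_left_comm, ih _ (colLen_ofParts_le hanti)]
    simp only [rowLen_ofParts hanti]
    rfl

/-! ### Antisymmetric polynomials -/

section polynomials
open MvPolynomial

/-- The variables of a polynomial ring in `n` variables, continued by `0`. -/
def finVars (n : ℕ) (i : ℕ) : MvPolynomial (Fin n) ℚ :=
  if h : i < n then X ⟨i, h⟩ else 0

theorem finVars_val {n : ℕ} (i : Fin n) : finVars n i = X i := by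
  simp [finVars]

/-- The exponent vector with entries `p i + (n - 1 - i)`. -/
def shiftedExp {n : ℕ} (p : Fin n → ℕ) : Fin n →₀ ℕ :=
  Finsupp.equivFunOnFinite.symm fun i => p i + (n - 1 - i)

theorem shiftedExp_apply {n : ℕ} (p : Fin n → ℕ) (i : Fin n) :
    shiftedExp p i = p i + (n - 1 - i) :=
  rfl

theorem shiftedAlternant_eq_sum {n : ℕ} (p : Fin n → ℕ) :
    shiftedAlternant (finVars n) n p = ∑ σ : Equiv.Perm (Fin n),
      monomial ((shiftedExp p).mapDomain σ) ((Equiv.Perm.sign σ : ℤ) : ℚ) := by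
  rw [shiftedAlternant, alternant, Matrix.det_apply']
  refine Finset.sum_congr rfl fun σ _ => ?_
  simp only [Matrix.of_apply, finVars_val]
  have h1 : (((Equiv.Perm.sign σ : ℤ) : MvPolynomial (Fin n) ℚ)) =
      C ((Equiv.Perm.sign σ : ℤ) : ℚ) := by simp
  rw [h1]
  have h2 : (shiftedExp p).mapDomain σ =
      ∑ i, Finsupp.single (σ i) (p i + (n - 1 - i)) := by
    rw [Finsupp.mapDomain, Finsupp.sum_fintype _ _ (by simp)]
    rfl
  rw [h2, ← mul_one ((Equiv.Perm.sign σ : ℤ) : ℚ), ← C_mul_monomial, monomial_sum_one, mul_one]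
  congr 1
  exact Finset.prod_congr rfl fun i _ => X_pow_eq_monomial

/-- Antisymmetric polynomials. -/
def IsAntisymmetric {n : ℕ} (p : MvPolynomial (Fin n) ℚ) : Prop :=
  ∀ σ : Equiv.Perm (Fin n), rename σ p = C ((Equiv.Perm.sign σ : ℤ) : ℚ) * p

theorem isAntisymmetric_shiftedAlternant {n : ℕ} (p : Fin n → ℕ) :
    IsAntisymmetric (shiftedAlternant (finVars n) n p) := by
  intro σ
  rw [shiftedAlternant_eq_sum, map_sum, Finset.mul_sum]
  refine Fintype.sum_equiv (Equiv.mulLeft σ) _ _ fun τ => ?_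
  rw [rename_monomial, C_mul_monomial, ← Finsupp.mapDomain_comp, Equiv.coe_mulLeft,
    Equiv.Perm.sign_mul]
  congr 1
  · simp only [Units.val_mul, ← mul_assoc, ← Int.cast_mul, Int.units_coe_mul_self,
      one_mul]

theorem IsAntisymmetric.sub {n : ℕ} {p q : MvPolynomial (Fin n) ℚ} (hp : IsAntisymmetric p)
    (hq : IsAntisymmetric q) : IsAntisymmetric (p - q) := by
  intro σ
  rw [map_sub, hp, hq, mul_sub]

theorem IsAntisymmetric.sum {n : ℕ} {ι : Type*} (s : Finset ι) (c : ι → ℚ)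
    (p : ι → MvPolynomial (Fin n) ℚ) (h : ∀ i ∈ s, IsAntisymmetric (p i)) :
    IsAntisymmetric (∑ i ∈ s, C (c i) * p i) := by
  intro σ
  rw [map_sum, Finset.mul_sum]
  refine Finset.sum_congr rfl fun i hi => ?_
  rw [map_mul, rename_C, h i hi, mul_left_comm]

theorem IsAntisymmetric.coeff_mapDomain {n : ℕ} {p : MvPolynomial (Fin n) ℚ}
    (hp : IsAntisymmetric p) (σ : Equiv.Perm (Fin n)) (e : Fin n →₀ ℕ) :
    coeff e p = ((Equiv.Perm.sign σ : ℤ) : ℚ) * coeff (e.mapDomain σ) p := by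
  rw [← coeff_C_mul, ← hp, coeff_rename_mapDomain _ σ.injective]

theorem mapDomain_perm_apply {n : ℕ} (σ : Equiv.Perm (Fin n)) (e : Fin n →₀ ℕ) (i : Fin n) :
    e.mapDomain σ i = e (σ.symm i) := by
  conv_lhs => rw [← σ.apply_symm_apply i]
  exact Finsupp.mapDomain_apply σ.injective _ _

/-- An exponent vector with distinct entries can be sorted at the cost of a sign. If two entries
agree, swapping them shows that the coefficient is its own negative. -/
theorem IsAntisymmetric.eq_zero {n : ℕ} {p : MvPolynomial (Fin n) ℚ}
    (hp : IsAntisymmetric p) (h : ∀ e : Fin n →₀ ℕ, StrictAnti e → coeff e p = 0) : p = 0 := by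
  ext e
  rw [coeff_zero]
  by_cases he : Function.Injective e
  · let σ : Equiv.Perm (Fin n) := Fin.revPerm.trans (Tuple.sort e)
    rw [hp.coeff_mapDomain σ.symm, h, mul_zero]
    have hanti : Antitone (e.mapDomain σ.symm) := by
      intro i j hij
      rw [mapDomain_perm_apply, mapDomain_perm_apply]
      exact Tuple.monotone_sort e (Fin.rev_le_rev.2 hij)
    refine hanti.strictAnti_of_injective fun i j hij => ?_
    rw [mapDomain_perm_apply, mapDomain_perm_apply] at hij
    exact σ.symm.symm.injective (he hij)
  · rw [Function.Injective] at he
    push Not at he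
    obtain ⟨i, j, hij, hne⟩ := he
    have h1 := hp.coeff_mapDomain (Equiv.swap i j) e
    have h2 : e.mapDomain (Equiv.swap i j) = e := by
      ext k
      rw [mapDomain_perm_apply, Equiv.symm_swap, Equiv.apply_swap_eq_self hij]
    rw [h2, Equiv.Perm.sign_swap hne] at h1
    simp only [Units.val_neg, Units.val_one, Int.cast_neg, Int.cast_one] at h1
    linarith

theorem shiftedExp_strictAnti {n : ℕ} {p : Fin n → ℕ} (hp : Antitone p) :
    StrictAnti (shiftedExp p) := by
  intro i j hij
  have h1 := hp hij.le
  have h2 := j.2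
  rw [Fin.lt_def] at hij
  simp only [shiftedExp_apply]
  omega

theorem exists_shiftedExp {n : ℕ} {e : Fin n →₀ ℕ} (he : StrictAnti e) :
    ∃ p : Fin n → ℕ, Antitone p ∧ e = shiftedExp p := by
  have key : ∀ k i j : ℕ, ∀ (hi : i < n) (hj : j < n), i + k = j →
      e ⟨j, hj⟩ + k ≤ e ⟨i, hi⟩ := by
    intro k
    induction k with
    | zero =>
      rintro i j hi hj rfl
      rfl
    | succ k ih =>
      rintro i j hi hj rfl
      have h1 := ih i (i + k) hi (by omega) rfl
      have h2 := he (show (⟨i + k, by omega⟩ : Fin n) < ⟨i + (k + 1), hj⟩ by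
        rw [Fin.lt_def]; simp)
      omega
  refine ⟨fun i => e i - (n - 1 - i), fun i j hij => ?_, ?_⟩
  · have h1 := key (j - i) i j i.2 j.2 (by rw [Fin.le_def] at hij; omega)
    have h2 := j.2
    simp only [Fin.eta] at h1
    simp only
    rw [Fin.le_def] at hij
    omega
  · ext i
    have hi := i.2
    have h1 := key (n - 1 - i) i (n - 1) i.2 (by omega) (by omega)
    rw [shiftedExp_apply]
    simp only [Fin.eta] at h1
    omega

/-- A permutation carrying one strictly decreasing vector to another is strictly monotone, hence the
identity. -/
theorem coeff_shiftedExp_shiftedAlternant {n : ℕ} {p q : Fin n → ℕ} (hp : Antitone p)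
    (hq : Antitone q) [Decidable (q = p)] :
    coeff (shiftedExp p) (shiftedAlternant (finVars n) n q) = if q = p then 1 else 0 := by
  have key : ∀ σ : Equiv.Perm (Fin n), (shiftedExp q).mapDomain σ = shiftedExp p →
      σ = 1 ∧ q = p := by
    intro σ h
    have h1 : ∀ i, shiftedExp q i = shiftedExp p (σ i) := by
      intro i
      rw [← h, Finsupp.mapDomain_apply σ.injective]
    have hmono : StrictMono σ := by
      intro i j hij
      have h2 := shiftedExp_strictAnti hq hij
      rw [h1, h1] at h2
      exact (shiftedExp_strictAnti hp).lt_iff_gt.1 h2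
    have hσ : (σ : Fin n → Fin n) = id :=
      hmono.eq_id
    have hσ' : σ = 1 := Equiv.ext fun i => congrFun hσ i
    refine ⟨hσ', funext fun i => ?_⟩
    have h2 := h1 i
    rw [hσ', Equiv.Perm.one_apply, shiftedExp_apply, shiftedExp_apply] at h2
    omega
  rw [shiftedAlternant_eq_sum, coeff_sum]
  simp only [coeff_monomial]
  split_ifs with hqp
  · subst hqp
    rw [Finset.sum_eq_single 1]
    · simp
    · intro σ _ hσ
      exact if_neg fun h => hσ (key σ h).1
    · simp
  · exact Finset.sum_eq_zero fun σ _ => if_neg fun h => hqp (key σ h).2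

end polynomials

/-! ### The chromatic polynomial of an incomparability graph -/

section chromatic
open MvPolynomial
variable (P : Type*) [Fintype P] [PartialOrder P]

open Classical in
/-- The proper colourings of the incomparability graph with `n` colours. -/
def finColorings (n : ℕ) : Finset (P → Fin n) :=
  Finset.univ.filter fun C => ∀ v w, (incGraph P).Adj v w → C v ≠ C w

theorem mem_finColorings {n : ℕ} {C : P → Fin n} :
    C ∈ finColorings P n ↔ ∀ v w, (incGraph P).Adj v w → C v ≠ C w := by
  simp [finColorings]

/-- The chromatic symmetric function in `n` variables. -/
def chromPoly (n : ℕ) : MvPolynomial (Fin n) ℚ :=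
  ∑ C ∈ finColorings P n, monomial (∑ v, Finsupp.single (C v) 1) 1

theorem rename_chromPoly {n : ℕ} (σ : Equiv.Perm (Fin n)) :
    rename σ (chromPoly P n) = chromPoly P n := by
  rw [chromPoly, map_sum]
  refine Finset.sum_bij' (fun C _ => σ ∘ C) (fun C _ => σ.symm ∘ C) ?_ ?_ ?_ ?_ ?_
  · intro C hC
    rw [mem_finColorings] at hC ⊢
    exact fun v w h e => hC v w h (σ.injective e)
  · intro C hC
    rw [mem_finColorings] at hC ⊢
    exact fun v w h e => hC v w h (σ.symm.injective e)
  · intro C _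
    funext v
    simp
  · intro C _
    funext v
    simp
  · intro C _
    rw [rename_monomial, Finsupp.mapDomain_finsetSum]
    simp only [Finsupp.mapDomain_single, Function.comp]

theorem coeff_chromPoly {n : ℕ} (α : Fin n →₀ ℕ) :
    coeff α (chromPoly P n) = coeff (setExp Finset.univ) (∏ i, chainPoly P (α i)) := by
  classical
  rw [← card_colorings_eq_coeff, chromPoly, coeff_sum]
  simp only [coeff_monomial]
  rw [← Finset.sum_filter, Finset.sum_const, nsmul_one, finColorings, Finset.filter_filter,
    Nat.cast_inj]
  congr 1
  ext C
  simp only [Finset.mem_filter, Finset.mem_univ, true_and]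
  refine and_congr (by simp) ?_
  rw [DFunLike.ext_iff]
  refine forall_congr' fun i => ?_
  rw [Finsupp.finsetSum_apply, Finset.card_filter]
  simp only [Finsupp.single_apply]

/-- The two permutation sums agree term by term: at `σ i` the exponent λ + δ - σδ equals λ_{σ i} - σ
i + i, the index of the matrix entry at (σ i, i). If one of these is negative, both terms vanish. -/
theorem coeff_shiftedAlternant_mul_chromPoly {n : ℕ} (lam : YoungDiagram)
    (hn : lam.colLen 0 ≤ n) :
    coeff (shiftedExp fun i : Fin n => lam.rowLen i)
        (shiftedAlternant (finVars n) n 0 * chromPoly P n) =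
      ∑ w ∈ words (Finset.univ : Finset P), signedCount lam w := by
  classical
  rw [sum_words_signedCount lam hn, Matrix.det_apply', shiftedAlternant_eq_sum, Finset.sum_mul,
    coeff_sum, coeff_sum]
  refine Finset.sum_congr rfl fun σ _ => ?_
  have h1 : (((Equiv.Perm.sign σ : ℤ) : MvPolynomial P ℚ)) =
      C ((Equiv.Perm.sign σ : ℤ) : ℚ) := by simp
  rw [h1, coeff_C_mul, coeff_monomial_mul']
  have hiff : ((shiftedExp (0 : Fin n → ℕ)).mapDomain σ ≤ shiftedExp fun i : Fin n => lam.rowLen i)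
      ↔ ∀ i, (σ i : ℕ) ≤ lam.rowLen (σ i) + i := by
    rw [Finsupp.le_def, ← σ.forall_congr_right]
    refine forall_congr' fun i => ?_
    rw [Finsupp.mapDomain_apply σ.injective, shiftedExp_apply, shiftedExp_apply, Pi.zero_apply]
    have h2 := i.2
    have h3 := (σ i).2
    omega
  by_cases h : ∀ i, (σ i : ℕ) ≤ lam.rowLen (σ i) + i
  · rw [if_pos (hiff.2 h), coeff_chromPoly]
    congr 2
    rw [← Equiv.prod_comp σ]
    refine Finset.prod_congr rfl fun i _ => ?_
    rw [jacobiTrudi, Matrix.of_apply, if_pos (h i)]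
    congr 1
    rw [Finsupp.tsub_apply, Finsupp.mapDomain_apply σ.injective, shiftedExp_apply,
      shiftedExp_apply, Pi.zero_apply]
    have h2 := i.2
    have h3 := (σ i).2
    have h4 := h i
    omega
  · rw [if_neg fun h' => h (hiff.1 h')]
    push Not at h
    obtain ⟨i, hi⟩ := h
    rw [Finset.prod_eq_zero (Finset.mem_univ i), coeff_zero, mul_zero]
    rw [jacobiTrudi, Matrix.of_apply, if_neg (not_le.2 hi)]

/-! ### Coefficients in finitely many variables -/

theorem lt_of_mapDomain_val_ne_zero {n : ℕ} {d : Fin n →₀ ℕ} {k : ℕ}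
    (h : d.mapDomain Fin.val k ≠ 0) : k < n := by
  by_contra hk
  exact h (Finsupp.mapDomain_of_notMem_range _ _ fun ⟨i, hi⟩ => hk (hi ▸ i.2))

theorem sum_single_ne_zero {ι : Type*} (s : Finset ι) (f : ι → ℕ) {i : ι} (hi : i ∈ s) :
    (∑ j ∈ s, Finsupp.single (f j) 1 : ℕ →₀ ℕ) (f i) ≠ 0 := by
  rw [Finsupp.finsetSum_apply]
  exact (Finset.sum_pos' (fun _ _ => Nat.zero_le _) ⟨i, hi, by simp⟩).ne'

/-- A monomial in the first `n` variables only sees colourings whose colours are all below `n`. -/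
theorem coeff_chromPoly_eq {n : ℕ} (d : Fin n →₀ ℕ) :
    coeff d (chromPoly P n) = chromaticSymm (incGraph P) (d.mapDomain Fin.val) := by
  classical
  have hweight : ∀ C : P → Fin n, (∑ v, Finsupp.single (C v : ℕ) 1 : ℕ →₀ ℕ) =
      (∑ v, Finsupp.single (C v) 1 : Fin n →₀ ℕ).mapDomain Fin.val := by
    intro C
    rw [Finsupp.mapDomain_finsetSum]
    simp only [Finsupp.mapDomain_single]
  rw [chromPoly, coeff_sum]
  simp only [coeff_monomial]
  rw [← Finset.sum_filter, Finset.sum_const, nsmul_one, chromaticSymm, Nat.cast_inj,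
    ← Fintype.card_coe, ← Nat.card_eq_fintype_card]
  refine Nat.card_eq_of_bijective (fun C => ⟨SimpleGraph.Coloring.mk (fun v => (C.1 v : ℕ))
    fun {v w} h e => (mem_finColorings P).1 (Finset.mem_filter.1 C.2).1 v w h (Fin.ext e), ?_⟩)
    ⟨?_, ?_⟩
  · exact (hweight C.1).trans (congrArg _ (Finset.mem_filter.1 C.2).2)
  · intro C D h
    apply Subtype.ext
    funext v
    exact Fin.ext (DFunLike.congr_fun (congrArg Subtype.val h) v)
  · rintro ⟨C, hC⟩
    have hlt : ∀ v, C v < n := fun v =>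
      lt_of_mapDomain_val_ne_zero (d := d) (by
        rw [← hC]
        exact sum_single_ne_zero _ C (Finset.mem_univ v))
    refine ⟨⟨fun v => ⟨C v, hlt v⟩, Finset.mem_filter.2 ⟨(mem_finColorings P).2
      fun v w h e => C.valid h (congrArg Fin.val e), ?_⟩⟩, rfl⟩
    apply Finsupp.mapDomain_injective (Fin.val_injective (n := n))
    rw [← hweight, ← hC]
    rfl

theorem coeff_schurPoly_eq {n : ℕ} (lam : YoungDiagram) (d : Fin n →₀ ℕ) :
    coeff d (schurPoly (finVars n) n lam) = schur lam (d.mapDomain Fin.val) := by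
  classical
  have hmon : ∀ Q : BoundedSSYT n lam,
      rename Fin.val (∏ c ∈ lam.cells, finVars n (Q.1 c.1 c.2)) =
        monomial (ssytWeight Q.1) (1 : ℚ) := by
    intro Q
    rw [map_prod, ssytWeight, monomial_sum_one]
    refine Finset.prod_congr rfl fun c hc => ?_
    rw [finVars, dif_pos (Q.2 c hc), rename_X]
    rfl
  rw [← coeff_rename_mapDomain _ (Fin.val_injective (n := n)), schurPoly, map_sum, coeff_sum]
  simp only [hmon, coeff_monomial]
  rw [← Finset.sum_filter, Finset.sum_const, nsmul_one, schur, Nat.cast_inj,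
    ← Fintype.card_coe, ← Nat.card_eq_fintype_card]
  refine Nat.card_eq_of_bijective (fun Q => ⟨Q.1.1, (Finset.mem_filter.1 Q.2).2⟩) ⟨?_, ?_⟩
  · intro Q Q' h
    simp only [Subtype.mk.injEq] at h
    exact Subtype.ext (Subtype.ext h)
  · rintro ⟨Q, hQ⟩
    refine ⟨⟨⟨Q, fun c hc => lt_of_mapDomain_val_ne_zero (d := d) ?_⟩,
      Finset.mem_filter.2 ⟨Finset.mem_univ _, hQ⟩⟩, rfl⟩
    rw [← hQ]
    exact sum_single_ne_zero lam.cells (fun c => Q c.1 c.2) hc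

end chromatic

/-! ### Schur expansions -/

section expansion
open MvPolynomial
variable {P : Type*} [Fintype P] [PartialOrder P]

theorem coeff_linearCombination_schur (a : YoungDiagram →₀ ℚ) (d : ℕ →₀ ℕ) :
    MvPowerSeries.coeff d (Finsupp.linearCombination ℚ schur a) =
      ∑ mu ∈ a.support, a mu * schur mu d := by
  rw [Finsupp.linearCombination_apply, Finsupp.sum, map_sum]
  refine Finset.sum_congr rfl fun mu _ => ?_
  rw [map_smul, smul_eq_mul]
  rfl

theorem chromPoly_eq_of_isSchurExpansion {a : YoungDiagram →₀ ℚ}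
    (h : IsSchurExpansion (chromaticSymm (incGraph P)) a) (n : ℕ) :
    chromPoly P n = ∑ mu ∈ a.support, C (a mu) * schurPoly (finVars n) n mu := by
  ext d
  have h1 : chromaticSymm (incGraph P) (d.mapDomain Fin.val) = _ :=
    (congrArg (MvPowerSeries.coeff (d.mapDomain Fin.val)) h).symm
  rw [coeff_chromPoly_eq, h1, coeff_linearCombination_schur, coeff_sum]
  exact Finset.sum_congr rfl fun mu _ => by rw [coeff_C_mul, coeff_schurPoly_eq]

theorem rowLen_antitone (lam : YoungDiagram) (n : ℕ) : Antitone fun i : Fin n => lam.rowLen i :=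
  fun i j hij => lam.rowLen_anti i j hij

theorem eq_of_rowLen_eq {lam mu : YoungDiagram} {n : ℕ} (hl : lam.colLen 0 ≤ n)
    (hm : mu.colLen 0 ≤ n) (h : (fun i : Fin n => lam.rowLen i) = fun i : Fin n => mu.rowLen i) :
    lam = mu := by
  have key : ∀ i, lam.rowLen i = mu.rowLen i := by
    intro i
    rcases Nat.lt_or_ge i n with hi | hi
    · exact congrFun h ⟨i, hi⟩
    · rw [rowLen_eq_zero_iff.2 (hl.trans hi), rowLen_eq_zero_iff.2 (hm.trans hi)]
  refine YoungDiagram.ext (Finset.ext ?_)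
  rintro ⟨i, j⟩
  rw [YoungDiagram.mem_cells, YoungDiagram.mem_cells, YoungDiagram.mem_iff_lt_rowLen,
    YoungDiagram.mem_iff_lt_rowLen, key]

open Classical in
-- By the bialternant formula each summand becomes a single alternant, and distinct shapes have
-- distinct leading exponents.
theorem coeff_shiftedAlternant_mul_sum {n : ℕ} (s : Finset YoungDiagram) (a : YoungDiagram → ℚ)
    (hs : ∀ mu ∈ s, mu.colLen 0 ≤ n) {lam : YoungDiagram} (hl : lam.colLen 0 ≤ n) :
    coeff (shiftedExp fun i : Fin n => lam.rowLen i)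
        (shiftedAlternant (finVars n) n 0 * ∑ mu ∈ s, C (a mu) * schurPoly (finVars n) n mu) =
      if lam ∈ s then a lam else 0 := by
  rw [Finset.mul_sum, coeff_sum, ← Finset.sum_ite_eq s lam a]
  refine Finset.sum_congr rfl fun mu hmu => ?_
  rw [mul_left_comm, shiftedAlternant_mul_schurPoly _ _ _ (hs mu hmu), coeff_C_mul,
    coeff_shiftedExp_shiftedAlternant (rowLen_antitone _ _) (rowLen_antitone _ _)]
  by_cases he : lam = mu
  · subst he
    simp
  · rw [if_neg he, if_neg fun h => he (eq_of_rowLen_eq (hs mu hmu) hl h).symm, mul_zero]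

/-- The right side does not involve `a`, so this yields both uniqueness and the value of whichever
expansion `schurCoeff` chooses. -/
theorem IsSchurExpansion.apply_eq {a : YoungDiagram →₀ ℚ}
    (h : IsSchurExpansion (chromaticSymm (incGraph P)) a) (lam : YoungDiagram) :
    a lam = ∑ w ∈ words (Finset.univ : Finset P), signedCount lam w := by
  classical
  -- There must be enough variables for the bialternant formula to apply to every shape involved.
  let n := max (lam.colLen 0) (a.support.sup fun mu => mu.colLen 0)
  have hl : lam.colLen 0 ≤ n := le_max_left _ _
  rw [← coeff_shiftedAlternant_mul_chromPoly P lam hl, chromPoly_eq_of_isSchurExpansion h n,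
    coeff_shiftedAlternant_mul_sum _ _ (fun mu hmu => ?_) hl]
  · split_ifs with hmem
    · rfl
    · exact Finsupp.notMem_support_iff.1 hmem
  · exact (Finset.le_sup (f := fun mu : YoungDiagram => mu.colLen 0) hmu).trans (le_max_right _ _)

theorem IsRimHookTabloid.sum_length {lam : YoungDiagram} {hs : List (List (ℕ × ℕ))}
    (h : IsRimHookTabloid lam hs) : (hs.map List.length).sum = lam.card := by
  rw [← List.length_flatten, ← List.toFinset_card_of_nodup h.flatten.1]
  congr 1
  ext c
  rw [List.mem_toFinset, h.flatten.2, YoungDiagram.mem_cells]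

theorem length_eq_of_signedCount_ne_zero {P : Type*} [PartialOrder P] {lam : YoungDiagram}
    {w : List P}
    (h : signedCount lam w ≠ 0) : w.length = lam.card := by
  obtain ⟨T, _, hT⟩ := Finset.exists_ne_zero_of_sum_ne_zero h
  rw [← T.isRimHookTabloid.sum_length]
  by_contra hne
  exact hT (if_neg fun hinc => hne hinc.length_eq)

/-- Block lengths add up to the size of the shape. Only shapes of size |P| occur, which gives finite
support and bounds the number of rows. -/
theorem card_eq_of_sum_signedCount_ne_zero {lam : YoungDiagram}
    (h : ∑ w ∈ words (Finset.univ : Finset P), signedCount lam w ≠ 0) :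
    lam.card = Fintype.card P := by
  classical
  obtain ⟨w, hw, hw'⟩ := Finset.exists_ne_zero_of_sum_ne_zero h
  rw [← length_eq_of_signedCount_ne_zero hw', ← List.toFinset_card_of_nodup (mem_words.1 hw).1,
    ← Finset.card_univ]
  congr 1
  ext v
  rw [List.mem_toFinset, (mem_words.1 hw).2]

theorem colLen_le_card (lam : YoungDiagram) : lam.colLen 0 ≤ lam.card := by
  rw [YoungDiagram.colLen_eq_card]
  exact Finset.card_le_card (Finset.filter_subset _ _)

theorem rowLen_le_card (lam : YoungDiagram) (i : ℕ) : lam.rowLen i ≤ lam.card := by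
  rw [YoungDiagram.rowLen_eq_card]
  exact Finset.card_le_card (Finset.filter_subset _ _)

theorem finite_card_eq (N : ℕ) : {lam : YoungDiagram | lam.card = N}.Finite := by
  refine Set.Finite.of_finite_image (f := YoungDiagram.cells)
    (((Finset.range N ×ˢ Finset.range N).powerset.finite_toSet).subset ?_)
    fun a _ b _ h => YoungDiagram.ext h
  rintro _ ⟨lam, rfl, rfl⟩
  rw [Finset.mem_coe, Finset.mem_powerset]
  rintro ⟨i, j⟩ hc
  rw [Finset.mem_product, Finset.mem_range, Finset.mem_range]
  refine ⟨?_, (YoungDiagram.mem_iff_lt_rowLen.1 hc).trans_le (rowLen_le_card _ _)⟩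
  exact (YoungDiagram.mem_iff_lt_colLen.1
    (lam.up_left_mem le_rfl (Nat.zero_le j) hc)).trans_le (colLen_le_card _)

variable (P) in
/-- The coefficients of the Schur expansion of the chromatic symmetric function. -/
def schurCoeffs : YoungDiagram →₀ ℚ :=
  Finsupp.ofSupportFinite
    (fun lam => ∑ w ∈ words (Finset.univ : Finset P), signedCount lam w)
    ((finite_card_eq (Fintype.card P)).subset fun _ h => card_eq_of_sum_signedCount_ne_zero h)

theorem schurCoeffs_apply (lam : YoungDiagram) :
    schurCoeffs P lam = ∑ w ∈ words (Finset.univ : Finset P), signedCount lam w :=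
  rfl

theorem shiftedAlternant_zero_ne_zero (n : ℕ) : shiftedAlternant (finVars n) n 0 ≠ 0 := by
  classical
  intro h
  have h1 := coeff_shiftedExp_shiftedAlternant (n := n) (p := 0) (q := 0) antitone_const
    antitone_const
  rw [h, if_pos rfl, coeff_zero] at h1
  exact zero_ne_one h1

/-- After multiplication by a_δ the difference of the two sides is antisymmetric and its
coefficients at all λ + δ vanish. So it is zero, and a_δ cancels in the polynomial domain. -/
theorem chromPoly_eq_sum {n : ℕ} (hn : Fintype.card P ≤ n) :
    chromPoly P n =
      ∑ mu ∈ (schurCoeffs P).support, C (schurCoeffs P mu) * schurPoly (finVars n) n mu := by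
  classical
  have hsupp : ∀ mu ∈ (schurCoeffs P).support, mu.colLen 0 ≤ n := by
    intro mu hmu
    have := card_eq_of_sum_signedCount_ne_zero (P := P) (Finsupp.mem_support_iff.1 hmu)
    exact (colLen_le_card mu).trans (this.trans_le hn)
  rw [← sub_eq_zero]
  refine (mul_eq_zero.1 (IsAntisymmetric.eq_zero (p := shiftedAlternant (finVars n) n 0 * _)
    ?_ ?_)).resolve_left (shiftedAlternant_zero_ne_zero n)
  · rw [mul_sub]
    refine IsAntisymmetric.sub ?_ ?_
    · intro σ
      rw [map_mul, isAntisymmetric_shiftedAlternant, rename_chromPoly, mul_assoc]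
    · rw [Finset.mul_sum]
      have : ∀ mu ∈ (schurCoeffs P).support, shiftedAlternant (finVars n) n 0 *
          (C (schurCoeffs P mu) * schurPoly (finVars n) n mu) =
          C (schurCoeffs P mu) * shiftedAlternant (finVars n) n fun i => mu.rowLen i :=
        fun mu hmu => by
          rw [mul_left_comm, shiftedAlternant_mul_schurPoly _ _ _ (hsupp mu hmu)]
      rw [Finset.sum_congr rfl this]
      exact IsAntisymmetric.sum _ _ _ fun mu _ => isAntisymmetric_shiftedAlternant _
  · intro e he
    obtain ⟨p, hp, rfl⟩ := exists_shiftedExp he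
    have hrow : p = fun i : Fin n => (ofParts p).rowLen i :=
      funext fun i => (rowLen_ofParts hp i).symm
    rw [hrow, mul_sub, coeff_sub, coeff_shiftedAlternant_mul_chromPoly _ _ (colLen_ofParts_le hp),
      coeff_shiftedAlternant_mul_sum _ _ hsupp (colLen_ofParts_le hp), ← schurCoeffs_apply]
    split_ifs with h
    · exact sub_self _
    · rw [Finsupp.notMem_support_iff.1 h, sub_self]

theorem isSchurExpansion_schurCoeffs :
    IsSchurExpansion (chromaticSymm (incGraph P)) (schurCoeffs P) := by
  refine MvPowerSeries.ext fun d => ?_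
  -- Any one coefficient can be checked in finitely many variables, once these include all variables
  -- of the monomial and number at least |P|.
  obtain ⟨n, hn, hd⟩ : ∃ n, Fintype.card P ≤ n ∧ ∀ i ∈ d.support, i < n :=
    ⟨max (Fintype.card P) (d.support.sup id + 1), le_max_left _ _, fun i hi =>
      (Nat.lt_succ_of_le (Finset.le_sup (f := id) hi)).trans_le (le_max_right _ _)⟩
  have hd' : (d.comapDomain (Fin.val : Fin n → ℕ) Fin.val_injective.injOn).mapDomain Fin.val =
      d :=
    Finsupp.mapDomain_comapDomain _ Fin.val_injective _ fun i hi => ⟨⟨i, hd i hi⟩, rfl⟩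
  have h1 : MvPowerSeries.coeff d (chromaticSymm (incGraph P)) =
      chromaticSymm (incGraph P) d := rfl
  rw [coeff_linearCombination_schur, h1, ← hd', ← coeff_chromPoly_eq, chromPoly_eq_sum hn,
    coeff_sum]
  exact Finset.sum_congr rfl fun mu _ => by rw [coeff_C_mul, coeff_schurPoly_eq]

end expansion

end SRH
end

theorem theorem4p6 {P : Type*} [Fintype P] [PartialOrder P] (lam : YoungDiagram) :
    (∃! a : YoungDiagram →₀ ℚ, SRH.IsSchurExpansion (SRH.chromaticSymm (SRH.incGraph P)) a) ∧
      SRH.schurCoeff lam (SRH.chromaticSymm (SRH.incGraph P)) =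
        ∑ T ∈ SRH.nonIncreasingTailTabloids (SRH.incGraph P) lam, (T.sgn : ℚ) := by
  have hex : ∃ a, SRH.IsSchurExpansion (SRH.chromaticSymm (SRH.incGraph P)) a :=
    ⟨_, SRH.isSchurExpansion_schurCoeffs⟩
  refine ⟨⟨_, SRH.isSchurExpansion_schurCoeffs, fun b hb => ?_⟩, ?_⟩
  · ext mu
    rw [hb.apply_eq, SRH.schurCoeffs_apply]
  · rw [SRH.schurCoeff, dif_pos hex, hex.choose_spec.apply_eq,
      SRH.sum_nonIncreasingTailTabloids]
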